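/- Let $n\ge 0$, let $B_2^n$ be the closed Euclidean unit ball of $\mathbb{R}^n$, and let $\mathcal{K}$ be the class of compact convex sets $K\subseteq\mathbb{R}^n$ with $0$ in their interior, with the Hausdorff metric. For $K$ in $\mathcal K$ and a unit vector $\theta$ let $r_K(\theta)=\sup\{r\ge 0: r\theta\in K\}$, and for $s>0$ let the naive power $P_s(K)=\operatorname{conv}\big(\{0\}\cup\{r\theta : |\theta|=1,\ 0\le r\le r_K(\theta)^s\}\big)$ be the convex hull of the star body with radial function $r_K^s$. For $0<\lambda<1$ and a partition $\Pi:\lambda=t_0<t_1<\dots<t_m=1$ of $[\lambda,1]$ put $s_i=t_{i-1}/t_i$ and $P_\Pi(K)=(P_{s_1}\circ P_{s_2}\circ\cdots\circ P_{s_m})(K)$; for $\lambda>1$ and a partition $\Pi:1=t_0<t_1<\dots<t_m=\lambda$ of $[1,\lambda]$ put $s_i=t_i/t_{i-1}$ and $P_\Pi(K)=(P_{s_m}\circ\cdots\circ P_{s_2}\circ P_{s_1})(K)$. Let $\|\Pi\|=\max_i|t_{i+1}-t_i|$. Define $K^0=B_2^n$, $K^1=K$, and $K^\lambda=\overline{\bigcup_\Pi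 P_\Pi(K)}$ for $\lambda\in(0,1)\cup(1,\infty)$, the union being over all partitions of $[\lambda,1]$, respectively of $[1,\lambda]$. Then $K^\lambda\in\mathcal{K}$ for every $K\in\mathcal{K}$ and $0\le\lambda<\infty$, and for $\lambda\in(0,1)\cup(1,\infty)$ one has $K^\lambda=\lim_{\|\Pi\|\to0}P_\Pi(K)$ in the following sense: for every $0<\varepsilon<1$ there is $\delta>0$ such that $(1-\varepsilon)K^\lambda\subseteq P_\Pi(K)\subseteq K^\lambda$ for every such partition $\Pi$ with $\|\Pi\|<\delta$. Moreover, for all $K,K_1,K_2\in\mathcal{K}$: 1. $K^1=K$ and $K^0=B_2^n$. 2. If $K_1\subseteq K_2$ then $K_1^\lambda\subseteq K_2^\lambda$ for all $0\le\lambda<\infty$. 3. $(tK)^\lambda=t^\lambda K^\lambda$ for all $t>0$ and $0\le\lambda<\infty$. 4. The map $(K,\lambda)\mapsto K^\lambda$ is (jointly) continuous from $\mathcal{K}\times[0,\infty)$ to $\mathcal{K}$. 5. $(K^\lambda)^\mu=K^{\lambda\mu}$ whenever $0\le\lambda,\mu\le1$, and whenever $1\le\lambda,\mu<\infty$. 6.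 If $aB_2^n\subseteq K\subseteq\sqrt2\,aB_2^n$ for some $a>0$, then $(K^\lambda)^{1/\lambda}=K$ for all $0<\lambda\le1$. -/

import Mathlib

open Set Metric
open scoped Pointwise NNReal

/-- Euclidean space `ℝⁿ`, with the Euclidean norm. -/
abbrev Euc (n : ℕ) : Type := EuclideanSpace ℝ (Fin n)

/-- The class of compact convex bodies in `ℝⁿ` having `0` in their interior. As a subtype of
`ConvexBody` it carries the Hausdorff metric. -/
abbrev OriginBody (n : ℕ) : Type :=
  {K : ConvexBody (Euc n) // (0 : Euc n) ∈ interior (K : Set (Euc n))}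

/-- The underlying set of points of a body. -/
def OriginBody.toSet {n : ℕ} (K : OriginBody n) : Set (Euc n) := (K.1 : Set (Euc n))

/-- The dilation `tK` of a body, for `t > 0`. -/
noncomputable def OriginBody.dilate {n : ℕ} (t : ℝ) (ht : 0 < t) (K : OriginBody n) :
    OriginBody n :=
  ⟨t • K.1, by
    rw [ConvexBody.coe_smul, interior_smul₀ ht.ne']
    exact ⟨0, K.2, smul_zero t⟩⟩

/-- The radial function `r_K(θ) = sup {r ≥ 0 : r θ ∈ K}` (used for unit vectors `θ`). -/
noncomputable def radialFun {n : ℕ} (K : Set (Euc n)) (θ : Euc n) : ℝ :=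
  sSup {r : ℝ | 0 ≤ r ∧ r • θ ∈ K}

/-- The star body with radial function `ρ`: the union of the segments `[0, ρ(θ) θ]` over all
unit vectors `θ`, together with the origin. -/
def starBody {n : ℕ} (ρ : Euc n → ℝ) : Set (Euc n) :=
  insert 0 {x | ∃ θ : Euc n, ‖θ‖ = 1 ∧ ∃ r : ℝ, 0 ≤ r ∧ r ≤ ρ θ ∧ x = r • θ}

/-- The naive power `P_s(K)`: the convex hull of the star body with radial function `r_K ^ s`. -/
noncomputable def naivePower {n : ℕ} (s : ℝ) (K : Set (Euc n)) : Set (Euc n) :=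
  convexHull ℝ (starBody fun θ => radialFun K θ ^ s)

/-- A partition `a = t₀ < t₁ < ⋯ < t_m = b` of the interval `[a, b]`
(only the values `t i` with `i ≤ m` matter). -/
structure IntervalPartition (a b : ℝ) where
  m : ℕ
  t : ℕ → ℝ
  t_first : t 0 = a
  t_last : t m = b
  t_lt : ∀ i < m, t i < t (i + 1)

/-- The mesh `max_i |t_{i+1} - t_i|` of the partition is less than `δ`. -/
def IntervalPartition.MeshLT {a b : ℝ} (Q : IntervalPartition a b) (δ : ℝ) : Prop :=
  ∀ i < Q.m, |Q.t (i + 1) - Q.t i| < δ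

/-- For `s_i = t_{i-1} / t_i`, the composition `P_{s_1} ∘ P_{s_2} ∘ ⋯ ∘ P_{s_m}` applied to `K`
(`P_{s_m}` acts first). -/
noncomputable def lowerIterate {n : ℕ} (t : ℕ → ℝ) : ℕ → Set (Euc n) → Set (Euc n)
  | 0, K => K
  | m + 1, K => lowerIterate t m (naivePower (t m / t (m + 1)) K)

/-- For `s_i = t_i / t_{i-1}`, the composition `P_{s_m} ∘ ⋯ ∘ P_{s_2} ∘ P_{s_1}` applied to `K`
(`P_{s_1}` acts first). -/
noncomputable def upperIterate {n : ℕ} (t : ℕ → ℝ) : ℕ → Set (Euc n) → Set (Euc n)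
  | 0, K => K
  | m + 1, K => naivePower (t (m + 1) / t m) (upperIterate t m K)

/-- `P_Π(K)` for a partition `Π` of `[p, 1]`, where `0 < p < 1`. -/
noncomputable def lowerPower {n : ℕ} {p : ℝ} (Q : IntervalPartition p 1) (K : Set (Euc n)) :
    Set (Euc n) :=
  lowerIterate Q.t Q.m K

/-- `P_Π(K)` for a partition `Π` of `[1, p]`, where `p > 1`. -/
noncomputable def upperPower {n : ℕ} {p : ℝ} (Q : IntervalPartition 1 p) (K : Set (Euc n)) :
    Set (Euc n) :=
  upperIterate Q.t Q.m K

open Classical in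
/-- The power `K ^ p`, `p ≥ 0`, as a set: the unit ball for `p = 0`, `K` itself for `p = 1`, and
otherwise the closure of the union of `P_Π(K)` over all partitions `Π` of `[p, 1]`
(resp. of `[1, p]`). -/
noncomputable def powerSet {n : ℕ} (p : ℝ) (K : Set (Euc n)) : Set (Euc n) :=
  if p = 0 then closedBall 0 1
  else if p = 1 then K
  else if p < 1 then closure (⋃ Q : IntervalPartition p 1, lowerPower Q K)
  else closure (⋃ Q : IntervalPartition 1 p, upperPower Q K)

/-! On the bodies considered, the naive power is the convex hull of the image under r θ ↦ r ^ s θ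
(`hullPow`). A partition is recorded by its list of ratios, which all lie in (0, 1] or all in [1, ∞)
and have product λ. Such lists replace partitions throughout.

The monotonicity principle is `hullPow_mul_subset`: splitting an exponent as a product can only
enlarge the result, because one more hull is taken on the way. Two lists with the same product have
a common refinement, so the union defining K^λ is directed. Hence its closure is convex and, by
compactness, is contained in a dilate, with factor arbitrarily close to 1, of a single composite
power.

All errors are measured by dilations. If A lies between the balls of radii M⁻¹ and M, replacing
exponent s by t costs a factor M ^ |s - t|. Since the exponents of a list lie on one side of 1, the
costs telescope: a composite of product λ agrees with A up to the factor M ^ |λ - 1|, however many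
steps it has. Composites are monotone and homogeneous, so dilations pass through them. This yields
the semigroup law, the Lipschitz dependence on λ, and the limit along fine partitions: a fine list
can be cut close to each partial product of a fixed list (`exists_mesh_powList_subset`).
Hausdorff-close bodies agree up to a dilation close to 1, which gives joint continuity.

For inversion, a body between the balls of radii a and √2 a has position and normal vectors at angle
at most π/4. A second derivative test along segments then shows that its radial powers with exponent
at most 1 are convex. So no hull changes anything, either on the way down to λ or on the way back,
and the two radial powers cancel. -/

section Pinched

variable {E : Type*} [NormedAddCommGroup E]

/-- `A` lies between the balls of radii `M⁻¹` and `M`. -/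
structure Pinched (M : ℝ) (A : Set E) : Prop where
  one_le : 1 ≤ M
  ball_subset : closedBall 0 M⁻¹ ⊆ A
  subset_ball : A ⊆ closedBall 0 M

theorem Pinched.pos {M : ℝ} {A : Set E} (h : Pinched M A) : 0 < M := one_pos.trans_le h.one_le

theorem Pinched.one_le_rpow {M : ℝ} {A : Set E} (h : Pinched M A) {s : ℝ} (hs : 0 ≤ s) :
    1 ≤ M ^ s := Real.one_le_rpow h.one_le hs

theorem Pinched.mono {M N : ℝ} {A : Set E} (h : Pinched M A) (hMN : M ≤ N) : Pinched N A :=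
  ⟨h.one_le.trans hMN, (closedBall_subset_closedBall (inv_anti₀ h.pos hMN)).trans h.ball_subset,
    h.subset_ball.trans (closedBall_subset_closedBall hMN)⟩

theorem Pinched.zero_mem_interior {M : ℝ} {A : Set E} (h : Pinched M A) : (0 : E) ∈ interior A :=
  mem_interior_iff_mem_nhds.2
    (Filter.mem_of_superset (closedBall_mem_nhds 0 (inv_pos.2 h.pos)) h.ball_subset)

end Pinched

/-! ### Radial powers and their convex hulls -/

section RadialPow

variable {E : Type*} [NormedAddCommGroup E] [NormedSpace ℝ E]

/-- The radial power map `r θ ↦ r ^ s θ`. -/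
noncomputable def radialPow (s : ℝ) (x : E) : E := ‖x‖ ^ (s - 1) • x

@[simp] theorem radialPow_zero (s : ℝ) : radialPow s (0 : E) = 0 := by simp [radialPow]

@[simp] theorem radialPow_one (x : E) : radialPow 1 x = x := by simp [radialPow]

theorem norm_radialPow {s : ℝ} (hs : 0 < s) (x : E) : ‖radialPow s x‖ = ‖x‖ ^ s := by
  rcases eq_or_ne x 0 with rfl | hx
  · simp [Real.zero_rpow hs.ne']
  · have h : 0 < ‖x‖ := norm_pos_iff.2 hx
    rw [radialPow, norm_smul, Real.norm_of_nonneg (by positivity), ← Real.rpow_add_one h.ne']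
    ring_nf

theorem radialPow_radialPow {s : ℝ} (hs : 0 < s) (t : ℝ) (x : E) :
    radialPow t (radialPow s x) = radialPow (s * t) x := by
  rcases eq_or_ne x 0 with rfl | hx
  · simp
  · have h : 0 < ‖x‖ := norm_pos_iff.2 hx
    rw [radialPow, norm_radialPow hs, radialPow, radialPow, smul_smul, ← Real.rpow_mul h.le,
      ← Real.rpow_add h]
    ring_nf

theorem radialPow_smul (s : ℝ) {c : ℝ} (hc : 0 < c) (x : E) :
    radialPow s (c • x) = c ^ s • radialPow s x := by
  have : c ^ s = c ^ (s - 1) * c := by rw [← Real.rpow_add_one hc.ne']; ring_nf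
  rw [radialPow, radialPow, norm_smul, Real.norm_of_nonneg hc.le,
    Real.mul_rpow hc.le (norm_nonneg x), smul_smul, smul_smul, this]
  ring_nf

theorem continuous_radialPow {s : ℝ} (hs : 0 < s) : Continuous (radialPow s : E → E) := by
  rw [continuous_iff_continuousAt]
  intro x
  rcases eq_or_ne x 0 with rfl | hx
  · rw [ContinuousAt, radialPow_zero, tendsto_zero_iff_norm_tendsto_zero]
    simp only [norm_radialPow hs]
    have : Continuous fun y : E => ‖y‖ ^ s := continuous_norm.rpow_const fun _ => Or.inr hs.le
    simpa [Real.zero_rpow hs.ne'] using this.tendsto 0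
  · exact (continuous_norm.continuousAt.rpow_const (Or.inl (norm_ne_zero_iff.2 hx))).smul
      continuousAt_id

theorem radialPow_image_image {s : ℝ} (hs : 0 < s) (t : ℝ) (A : Set E) :
    radialPow t '' (radialPow s '' A) = radialPow (s * t) '' A := by
  rw [image_image]
  exact image_congr fun x _ => radialPow_radialPow hs t x

theorem radialPow_one_image (A : Set E) : radialPow 1 '' A = A := by simp

theorem radialPow_image_smul (s : ℝ) {c : ℝ} (hc : 0 < c) (A : Set E) :
    radialPow s '' (c • A) = c ^ s • (radialPow s '' A) := by
  rw [← image_smul, ← image_smul, image_image, image_image]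
  exact image_congr fun x _ => radialPow_smul s hc x

theorem radialPow_image_subset_closedBall {s r : ℝ} (hs : 0 < s) {A : Set E}
    (h : A ⊆ closedBall 0 r) : radialPow s '' A ⊆ closedBall 0 (r ^ s) := by
  rintro _ ⟨x, hx, rfl⟩
  have hx := h hx
  rw [mem_closedBall_zero_iff] at hx ⊢
  rw [norm_radialPow hs]
  exact Real.rpow_le_rpow (norm_nonneg x) hx hs.le

theorem closedBall_subset_radialPow_image {s r : ℝ} (hs : 0 < s) (hr : 0 ≤ r) {A : Set E}
    (h : closedBall 0 r ⊆ A) : closedBall 0 (r ^ s) ⊆ radialPow s '' A := by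
  intro y hy
  refine ⟨radialPow s⁻¹ y, h ?_, ?_⟩
  · rw [mem_closedBall_zero_iff] at hy ⊢
    rw [norm_radialPow (inv_pos.2 hs)]
    calc ‖y‖ ^ s⁻¹ ≤ (r ^ s) ^ s⁻¹ := Real.rpow_le_rpow (norm_nonneg y) hy (inv_pos.2 hs).le
      _ = r := Real.rpow_rpow_inv hr hs.ne'
  · rw [radialPow_radialPow (inv_pos.2 hs), inv_mul_cancel₀ hs.ne', radialPow_one]

/-- A star-shaped set around the origin is monotone under dilations. -/
theorem StarConvex.smul_subset_smul {A : Set E} (hA : StarConvex ℝ 0 A) {c d : ℝ} (hc : 0 ≤ c)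
    (hcd : c ≤ d) : c • A ⊆ d • A := by
  rintro _ ⟨x, hx, rfl⟩
  rcases hc.eq_or_lt with rfl | hc
  · have h0 : (0 : E) ∈ A := by
      simpa using hA.smul_mem hx le_rfl zero_le_one
    exact ⟨0, h0, by simp⟩
  · have hd := hc.trans_le hcd
    refine ⟨(c / d) • x, hA.smul_mem hx (by positivity) ((div_le_one hd).2 hcd), ?_⟩
    simp only [smul_smul]
    rw [mul_div_cancel₀ _ hd.ne']

theorem StarConvex.radialPow_image {A : Set E} (hA : StarConvex ℝ 0 A) {s : ℝ} (hs : 0 < s) :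
    StarConvex ℝ 0 (radialPow s '' A) := by
  rw [starConvex_zero_iff]
  rintro _ ⟨x, hx, rfl⟩ a ha ha1
  rcases ha.eq_or_lt with rfl | ha
  · exact ⟨0, by simpa using hA.smul_mem hx le_rfl zero_le_one, by simp⟩
  · refine ⟨a ^ s⁻¹ • x, hA.smul_mem hx (by positivity)
      (Real.rpow_le_one ha.le ha1 (inv_pos.2 hs).le), ?_⟩
    rw [radialPow_smul s (by positivity), Real.rpow_inv_rpow ha.le hs.ne']

theorem Pinched.radialPow_image {M s : ℝ} {A : Set E} (h : Pinched M A) (hs : 0 < s) :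
    Pinched (M ^ s) (radialPow s '' A) := by
  refine ⟨h.one_le_rpow hs.le, ?_, radialPow_image_subset_closedBall hs h.subset_ball⟩
  rw [← Real.inv_rpow h.pos.le]
  exact closedBall_subset_radialPow_image hs (inv_pos.2 h.pos).le h.ball_subset

theorem Pinched.radialPow_image_subset {M s : ℝ} {A : Set E} (h : Pinched M A)
    (hA : StarConvex ℝ 0 A) (hs : 0 < s) : radialPow s '' A ⊆ M ^ |s - 1| • A := by
  rintro _ ⟨x, hx, rfl⟩
  have hM := h.pos
  have key : ‖x‖ ^ (s - 1) ≤ M ^ |s - 1| → radialPow s x ∈ M ^ |s - 1| • A := fun hle =>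
    hA.smul_subset_smul (by positivity) hle (smul_mem_smul_set hx)
  have hxM : ‖x‖ ≤ M := mem_closedBall_zero_iff.1 (h.subset_ball hx)
  rcases le_total 1 s with h1 | h1
  · apply key
    rw [abs_of_nonneg (by linarith)]
    exact Real.rpow_le_rpow (norm_nonneg x) hxM (by linarith)
  · rw [abs_of_nonpos (by linarith), neg_sub] at key ⊢
    rcases le_total M⁻¹ ‖x‖ with h2 | h2
    · apply key
      calc ‖x‖ ^ (s - 1) ≤ M⁻¹ ^ (s - 1) :=
            Real.rpow_le_rpow_of_nonpos (inv_pos.2 hM) h2 (by linarith)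
        _ = M ^ (1 - s) := by rw [Real.inv_rpow hM.le, ← Real.rpow_neg hM.le, neg_sub]
    -- Short vectors may be stretched by more than M ^ (1 - s), but their images still land in the
    -- dilate of the inner ball.
    · rw [mem_smul_set_iff_inv_smul_mem₀ (by positivity)]
      apply h.ball_subset
      rw [mem_closedBall_zero_iff, norm_smul, norm_radialPow hs, Real.norm_of_nonneg (by positivity)]
      calc (M ^ (1 - s))⁻¹ * ‖x‖ ^ s ≤ (M ^ (1 - s))⁻¹ * M⁻¹ ^ s := by
            gcongr
        _ = M⁻¹ := by
            rw [Real.inv_rpow hM.le, ← mul_inv, ← Real.rpow_add hM]; simp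

/-- Two radial powers of the same star-shaped set are comparable. -/
theorem Pinched.radialPow_image_subset_smul {M s t : ℝ} {A : Set E} (h : Pinched M A)
    (hA : StarConvex ℝ 0 A) (hs : 0 < s) (ht : 0 < t) :
    radialPow s '' A ⊆ M ^ |s - t| • (radialPow t '' A) := by
  have := (h.radialPow_image ht).radialPow_image_subset (hA.radialPow_image ht) (div_pos hs ht)
  rw [radialPow_image_image ht, mul_div_cancel₀ _ ht.ne', ← Real.rpow_mul h.pos.le] at this
  rwa [show t * |s / t - 1| = |s - t| by
    rw [← abs_of_pos ht, ← abs_mul, abs_of_pos ht]; congr 1; field_simp] at this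

/-- The convex hull of the radial power of a set. -/
noncomputable def hullPow (s : ℝ) (A : Set E) : Set E := convexHull ℝ (radialPow s '' A)

theorem hullPow_mono (s : ℝ) {A B : Set E} (h : A ⊆ B) : hullPow s A ⊆ hullPow s B :=
  convexHull_mono (image_mono h)

theorem hullPow_smul (s : ℝ) {c : ℝ} (hc : 0 < c) (A : Set E) :
    hullPow s (c • A) = c ^ s • hullPow s A := by
  rw [hullPow, radialPow_image_smul s hc, convexHull_smul, hullPow]

theorem convex_hullPow (s : ℝ) (A : Set E) : Convex ℝ (hullPow s A) := convex_convexHull _ _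

theorem hullPow_one {A : Set E} (hA : Convex ℝ A) : hullPow 1 A = A := by
  rw [hullPow, radialPow_one_image, hA.convexHull_eq]

/-- Radial powers compose exactly, and the right side takes an extra hull between the two. This is
why refining a partition enlarges the composite. -/
theorem hullPow_mul_subset {s : ℝ} (hs : 0 < s) (t : ℝ) (A : Set E) :
    hullPow (s * t) A ⊆ hullPow t (hullPow s A) := by
  rw [hullPow, ← radialPow_image_image hs]
  exact hullPow_mono t (subset_convexHull ℝ _)

theorem Pinched.hullPow {M s : ℝ} {A : Set E} (h : Pinched M A) (hs : 0 < s) :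
    Pinched (M ^ s) (hullPow s A) :=
  ⟨h.one_le_rpow hs.le, (h.radialPow_image hs).ball_subset.trans (subset_convexHull ℝ _),
    convexHull_min (h.radialPow_image hs).subset_ball (convex_closedBall 0 _)⟩

theorem Pinched.hullPow_subset_smul {M s t : ℝ} {A : Set E} (h : Pinched M A)
    (hA : StarConvex ℝ 0 A) (hs : 0 < s) (ht : 0 < t) :
    _root_.hullPow s A ⊆ M ^ |s - t| • _root_.hullPow t A := by
  rw [_root_.hullPow, _root_.hullPow, ← convexHull_smul]
  exact convexHull_mono (h.radialPow_image_subset_smul hA hs ht)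

end RadialPow

/-! ### Bodies around the origin and the star bodies of the statement -/

/-- The convex hull of a compact set in a finite-dimensional space is compact. -/
theorem IsCompact.isCompact_convexHull {E : Type*} [NormedAddCommGroup E] [NormedSpace ℝ E]
    -- Carathéodory: combinations of at most dim + 1 points suffice, so the hull is a finite union
    -- of continuous images of compact sets.
    [FiniteDimensional ℝ E] {A : Set E} (hA : IsCompact A) : IsCompact (convexHull ℝ A) := by
  have key : convexHull ℝ A = ⋃ k ∈ Iic (Module.finrank ℝ E + 1),
      (fun p : (Fin k → ℝ) × (Fin k → E) => ∑ i, p.1 i • p.2 i) ''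
        (stdSimplex ℝ (Fin k) ×ˢ Set.pi univ fun _ => A) := by
    apply Subset.antisymm
    · intro x hx
      obtain ⟨ι, _, z, w, hz, hind, hw, hw1, hsum⟩ := eq_pos_convex_span_of_mem_convexHull hx
      have hcard : Fintype.card ι ≤ Module.finrank ℝ E + 1 :=
        hind.card_le_finrank_succ.trans (by gcongr; exact Submodule.finrank_le _)
      let e := (Fintype.equivFin ι).symm
      refine mem_biUnion (mem_Iic.2 hcard) ⟨(w ∘ e, z ∘ e), ⟨⟨fun i => (hw _).le, ?_⟩, ?_⟩, ?_⟩
      · exact (e.sum_comp w).trans hw1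
      · exact fun i _ => hz ⟨e i, rfl⟩
      · exact (e.sum_comp fun i => w i • z i).trans hsum
    · simp only [iUnion_subset_iff]
      rintro k - _ ⟨⟨w, z⟩, ⟨⟨hw, hw1⟩, hz⟩, rfl⟩
      exact (convex_convexHull ℝ A).sum_mem (fun i _ => hw i) hw1
        fun i _ => subset_convexHull ℝ A (hz i trivial)
  rw [key]
  refine (finite_Iic _).isCompact_biUnion fun k _ => IsCompact.image
    ((isCompact_stdSimplex ℝ (Fin k)).prod (isCompact_univ_pi fun _ => hA)) ?_
  fun_prop

/-- A compact convex set with the origin in its interior. -/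
structure IsOriginBody {E : Type*} [NormedAddCommGroup E] [NormedSpace ℝ E] (A : Set E) :
    Prop where
  convex : Convex ℝ A
  isCompact : IsCompact A
  zero_mem_interior : (0 : E) ∈ interior A

section

variable {E : Type*} [NormedAddCommGroup E] [NormedSpace ℝ E] {A : Set E}

theorem IsOriginBody.zero_mem (h : IsOriginBody A) : (0 : E) ∈ A :=
  interior_subset h.zero_mem_interior

theorem IsOriginBody.starConvex (h : IsOriginBody A) : StarConvex ℝ 0 A :=
  h.convex.starConvex h.zero_mem

theorem IsOriginBody.exists_pinched (h : IsOriginBody A) : ∃ M, Pinched M A := by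
  obtain ⟨r, hr, hrA⟩ := Metric.mem_nhds_iff.1 (mem_interior_iff_mem_nhds.1 h.zero_mem_interior)
  obtain ⟨R, hR⟩ := h.isCompact.isBounded.subset_closedBall (0 : E)
  have hM : 2 / r ≤ max (max 1 R) (2 / r) := le_max_right _ _
  refine ⟨max (max 1 R) (2 / r), (le_max_left _ _).trans (le_max_left _ _), ?_,
    hR.trans (closedBall_subset_closedBall ((le_max_right _ _).trans (le_max_left _ _)))⟩
  refine (closedBall_subset_ball ?_).trans hrA
  calc (max (max 1 R) (2 / r))⁻¹ ≤ (2 / r)⁻¹ := inv_anti₀ (by positivity) hM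
    _ < r := by rw [inv_div]; linarith

theorem IsOriginBody.hullPow [FiniteDimensional ℝ E] (h : IsOriginBody A) {s : ℝ} (hs : 0 < s) :
    IsOriginBody (hullPow s A) := by
  obtain ⟨M, hM⟩ := h.exists_pinched
  exact ⟨convex_hullPow s A, (h.isCompact.image (continuous_radialPow hs)).isCompact_convexHull,
    (hM.hullPow hs).zero_mem_interior⟩

end

/-- Compactness makes the supremum in the radial function finite and attained, and star-shapedness
fills the segment below it. This links the naive power to `radialPow`. -/
theorem starBody_radialFun {n : ℕ} {K : Set (Euc n)} (hK : IsCompact K) (hstar : StarConvex ℝ 0 K)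
    (h0 : 0 ∈ K) {s : ℝ} (hs : 0 < s) :
    starBody (fun θ => radialFun K θ ^ s) = radialPow s '' K := by
  obtain ⟨R, hR⟩ := hK.isBounded.subset_closedBall (0 : Euc n)
  have hbdd : ∀ θ : Euc n, ‖θ‖ = 1 → BddAbove {r : ℝ | 0 ≤ r ∧ r • θ ∈ K} := by
    rintro θ hθ
    refine ⟨R, ?_⟩
    rintro r ⟨hr, hrK⟩
    have := mem_closedBall_zero_iff.1 (hR hrK)
    rwa [norm_smul, hθ, mul_one, Real.norm_of_nonneg hr] at this
  have hmem : ∀ θ : Euc n, ‖θ‖ = 1 → 0 ≤ radialFun K θ ∧ radialFun K θ • θ ∈ K := by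
    intro θ hθ
    have hcl : IsClosed {r : ℝ | 0 ≤ r ∧ r • θ ∈ K} :=
      isClosed_Ici.inter (hK.isClosed.preimage (continuous_id.smul continuous_const))
    exact hcl.csSup_mem ⟨0, le_rfl, by simpa using h0⟩ (hbdd θ hθ)
  apply Subset.antisymm
  · rintro x (rfl | ⟨θ, hθ, r, hr, hrle, rfl⟩)
    · exact ⟨0, h0, radialPow_zero s⟩
    · obtain ⟨hρ, hρK⟩ := hmem θ hθ
      rcases hr.eq_or_lt with rfl | hr
      · exact ⟨0, h0, by simp⟩
      have hle : r ^ s⁻¹ ≤ radialFun K θ := by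
        rw [← Real.rpow_rpow_inv hρ hs.ne']
        exact Real.rpow_le_rpow hr.le hrle (inv_pos.2 hs).le
      have hpos : 0 < radialFun K θ := (by positivity : 0 < r ^ s⁻¹).trans_le hle
      refine ⟨r ^ s⁻¹ • θ, ?_, ?_⟩
      · have := hstar.smul_mem hρK (t := r ^ s⁻¹ / radialFun K θ) (by positivity)
          ((div_le_one hpos).2 hle)
        rwa [smul_smul, div_mul_cancel₀ _ hpos.ne'] at this
      · rw [radialPow_smul s (by positivity), Real.rpow_inv_rpow hr.le hs.ne']
        simp [radialPow, hθ]
  · rintro _ ⟨x, hx, rfl⟩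
    rcases eq_or_ne x 0 with rfl | hx0
    · rw [radialPow_zero]
      exact mem_insert _ _
    · have hn : ‖x‖ ≠ 0 := norm_ne_zero_iff.2 hx0
      have hθ : ‖‖x‖⁻¹ • x‖ = 1 := norm_smul_inv_norm (𝕜 := ℝ) hx0
      refine Or.inr ⟨‖x‖⁻¹ • x, hθ, ‖x‖ ^ s, by positivity, ?_, ?_⟩
      · refine Real.rpow_le_rpow (norm_nonneg x) (le_csSup (hbdd _ hθ) ⟨norm_nonneg x, ?_⟩) hs.le
        rwa [smul_smul, mul_inv_cancel₀ hn, one_smul]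
      · rw [radialPow, smul_smul, Real.rpow_sub_one hn, div_eq_mul_inv]

theorem IsOriginBody.naivePower_eq {n : ℕ} {K : Set (Euc n)} (hK : IsOriginBody K) {s : ℝ}
    (hs : 0 < s) : naivePower s K = _root_.hullPow s K := by
  rw [naivePower, starBody_radialFun hK.isCompact hK.starConvex hK.zero_mem hs, _root_.hullPow]

/-! ### Exponent ranges -/

/-- The two ranges of exponents, `(0, 1]` and `[1, ∞)`. -/
def IsExponentRange (S : Set ℝ) : Prop := S = Ioc 0 1 ∨ S = Ici 1

namespace IsExponentRange

variable {S : Set ℝ} {s t : ℝ}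

theorem pos (hS : IsExponentRange S) (hs : s ∈ S) : 0 < s := by
  rcases hS with rfl | rfl
  · exact hs.1
  · exact one_pos.trans_le hs

theorem one_mem (hS : IsExponentRange S) : (1 : ℝ) ∈ S := by
  rcases hS with rfl | rfl <;> simp

theorem mul_mem (hS : IsExponentRange S) (hs : s ∈ S) (ht : t ∈ S) : s * t ∈ S := by
  rcases hS with rfl | rfl
  · exact ⟨mul_pos hs.1 ht.1, mul_le_one₀ hs.2 ht.1.le ht.2⟩
  · exact one_le_mul_of_one_le_of_one_le (mem_Ici.1 hs) (mem_Ici.1 ht)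

theorem div_mem_or (hS : IsExponentRange S) (hs : s ∈ S) (ht : t ∈ S) :
    s / t ∈ S ∨ t / s ∈ S := by
  have hs0 := hS.pos hs
  have ht0 := hS.pos ht
  rcases hS with rfl | rfl
  · rcases le_total s t with h | h
    · exact Or.inl ⟨div_pos hs0 ht0, (div_le_one ht0).2 h⟩
    · exact Or.inr ⟨div_pos ht0 hs0, (div_le_one hs0).2 h⟩
  · rcases le_total s t with h | h
    · exact Or.inr ((one_le_div hs0).2 h)
    · exact Or.inl ((one_le_div ht0).2 h)

theorem eq_one_of_mul_eq_one (hS : IsExponentRange S) (hs : s ∈ S) (ht : t ∈ S)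
    (h : s * t = 1) : s = 1 := by
  have hs0 := hS.pos hs
  rcases hS with rfl | rfl
  · nlinarith [hs.2, ht.2]
  · have hs := mem_Ici.1 hs
    nlinarith [mem_Ici.1 ht]

/-- Both factors lie on the same side of 1, so nothing cancels. This is the identity that makes
dilation costs telescope along a list. -/
theorem abs_mul_sub_one (hS : IsExponentRange S) (hs : s ∈ S) (ht : t ∈ S) :
    |s * t - 1| = s * |t - 1| + |s - 1| := by
  have hst := hS.mul_mem hs ht
  rcases hS with rfl | rfl
  · rw [abs_of_nonpos (by linarith [hst.2]), abs_of_nonpos (by linarith [ht.2]),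
      abs_of_nonpos (by linarith [hs.2])]
    ring
  · rw [mem_Ici] at hs ht hst
    rw [abs_of_nonneg (by linarith), abs_of_nonneg (by linarith), abs_of_nonneg (by linarith)]
    ring

theorem prod_mem (hS : IsExponentRange S) {l : List ℝ} (hl : ∀ s ∈ l, s ∈ S) : l.prod ∈ S := by
  induction l with
  | nil => simpa using hS.one_mem
  | cons s l ih =>
    rw [List.forall_mem_cons] at hl
    rw [List.prod_cons]
    exact hS.mul_mem hl.1 (ih hl.2)

end IsExponentRange

/-! ### Composite powers along lists of exponents -/

section PowList

variable {E : Type*} [NormedAddCommGroup E] [NormedSpace ℝ E]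

/-- The convex power maps with exponents `l`, applied successively from the head of `l` on. -/
noncomputable def powList : List ℝ → Set E → Set E
  | [], A => A
  | s :: l, A => powList l (hullPow s A)

theorem powList_append (l m : List ℝ) (A : Set E) :
    powList (l ++ m) A = powList m (powList l A) := by
  induction l generalizing A with
  | nil => rfl
  | cons s l ih => exact ih _

theorem powList_mono (l : List ℝ) {A B : Set E} (h : A ⊆ B) : powList l A ⊆ powList l B := by
  induction l generalizing A B with
  | nil => exact h
  | cons s l ih => exact ih (hullPow_mono s h)

variable {S : Set ℝ} {l : List ℝ} {A : Set E} {M : ℝ}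

theorem powList_smul (l : List ℝ) {c : ℝ} (hc : 0 < c) (A : Set E) :
    powList l (c • A) = c ^ l.prod • powList l A := by
  induction l generalizing c A with
  | nil => simp [powList]
  | cons s l ih =>
    rw [powList, hullPow_smul s hc, ih (by positivity), ← Real.rpow_mul hc.le, List.prod_cons,
      powList]

theorem IsOriginBody.powList [FiniteDimensional ℝ E] (hA : IsOriginBody A)
    (hl : ∀ s ∈ l, 0 < s) : IsOriginBody (powList l A) := by
  induction l generalizing A with
  | nil => exact hA
  | cons s l ih =>
    rw [List.forall_mem_cons] at hl
    exact ih (hA.hullPow hl.1) hl.2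

theorem Pinched.powList (h : Pinched M A) (hl : ∀ s ∈ l, 0 < s) :
    Pinched (M ^ l.prod) (powList l A) := by
  induction l generalizing A M with
  | nil => simpa [_root_.powList] using h
  | cons s l ih =>
    rw [List.forall_mem_cons] at hl
    have := ih (h.hullPow hl.1) hl.2
    rwa [← Real.rpow_mul h.pos.le] at this

theorem hullPow_prod_subset_powList (hA : Convex ℝ A) (hl : ∀ s ∈ l, 0 < s) :
    hullPow l.prod A ⊆ powList l A := by
  induction l generalizing A with
  | nil => rw [List.prod_nil, hullPow_one hA, powList]
  | cons s l ih =>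
    rw [List.forall_mem_cons] at hl
    rw [List.prod_cons]
    exact (hullPow_mul_subset hl.1 _ _).trans (ih (convex_hullPow s A) hl.2)

/-- After a step s the pinching constant is M ^ s, so the rest costs (M ^ s) ^ |t - 1| with t the
remaining product. Together with the cost M ^ |s - 1| of the step this is exactly M ^ |s t - 1|. -/
theorem Pinched.powList_subset_smul (hS : IsExponentRange S) (h : Pinched M A)
    (hA : Convex ℝ A) (hl : ∀ s ∈ l, s ∈ S) : _root_.powList l A ⊆ M ^ |l.prod - 1| • A := by
  induction l generalizing A M with
  | nil => simp [_root_.powList]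
  | cons s l ih =>
    rw [List.forall_mem_cons] at hl
    have hs := hS.pos hl.1
    have h0 : (0 : E) ∈ A := interior_subset h.zero_mem_interior
    have h1 := h.hullPow_subset_smul (hA.starConvex h0) hs one_pos
    rw [hullPow_one hA] at h1
    refine (ih (h.hullPow hs) (convex_hullPow s A) hl.2).trans ?_
    refine (smul_set_mono h1).trans ?_
    rw [smul_smul, ← Real.rpow_mul h.pos.le, ← Real.rpow_add h.pos, List.prod_cons,
      hS.abs_mul_sub_one hl.1 (hS.prod_mem hl.2)]

theorem Pinched.subset_smul_powList (h : Pinched M A) (hA : Convex ℝ A)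
    (hl : ∀ s ∈ l, 0 < s) : A ⊆ M ^ |l.prod - 1| • _root_.powList l A := by
  have h0 : (0 : E) ∈ A := interior_subset h.zero_mem_interior
  have h1 := h.hullPow_subset_smul (hA.starConvex h0) one_pos (List.prod_pos hl)
  rw [hullPow_one hA, abs_sub_comm] at h1
  exact h1.trans (smul_set_mono (hullPow_prod_subset_powList hA hl))

/-- Two exponent lists with the same product have a common refinement. -/
theorem exists_common_refinement (hS : IsExponentRange S) (l l' : List ℝ) (hl : ∀ s ∈ l, s ∈ S)
    (hl' : ∀ s ∈ l', s ∈ S) (h : l.prod = l'.prod) :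
    ∃ m : List ℝ, (∀ s ∈ m, s ∈ S) ∧ m.prod = l.prod ∧ ∀ A : Set E, Convex ℝ A →
      powList l A ⊆ powList m A ∧ powList l' A ⊆ powList m A := by
  -- Induction on the total length: the common head s is removed from both lists, after the other
  -- head s' is split as s * (s' / s).
  obtain ⟨n, hn⟩ : ∃ n, l.length + l'.length ≤ n := ⟨_, le_rfl⟩
  induction n generalizing l l' with
  | zero =>
    obtain ⟨rfl, rfl⟩ : l = [] ∧ l' = [] := by
      simpa using hn
    exact ⟨[], by simp, rfl, fun A _ => ⟨subset_rfl, subset_rfl⟩⟩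
  | succ n ih =>
    have nil_case : ∀ k : List ℝ, (∀ s ∈ k, s ∈ S) → k.prod = 1 → ∀ A : Set E, Convex ℝ A →
        A ⊆ powList k A := by
      intro k hk hk1 A hA
      have := hullPow_prod_subset_powList hA fun s hs => hS.pos (hk s hs)
      rwa [hk1, hullPow_one hA] at this
    have cons_case : ∀ (s s' : ℝ) (k k' : List ℝ), (∀ t ∈ s :: k, t ∈ S) →
        (∀ t ∈ s' :: k', t ∈ S) → (s :: k).prod = (s' :: k').prod →
        k.length + k'.length + 1 ≤ n → s' / s ∈ S →
        ∃ m : List ℝ, (∀ t ∈ m, t ∈ S) ∧ m.prod = (s :: k).prod ∧ ∀ A : Set E, Convex ℝ A →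
          powList (s :: k) A ⊆ powList m A ∧ powList (s' :: k') A ⊆ powList m A := by
      intro s s' k k' hk hk' hprod hlen hss
      rw [List.forall_mem_cons] at hk hk'
      rw [List.prod_cons, List.prod_cons] at hprod
      have hs := hS.pos hk.1
      obtain ⟨m, hm, hmp, hmA⟩ := ih k (s' / s :: k') hk.2
        (List.forall_mem_cons.2 ⟨hss, hk'.2⟩)
        (by rw [List.prod_cons, div_mul_eq_mul_div, ← hprod, mul_div_cancel_left₀ _ hs.ne'])
        (by rw [List.length_cons]; omega)
      refine ⟨s :: m, List.forall_mem_cons.2 ⟨hk.1, hm⟩, by rw [List.prod_cons, hmp,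
        List.prod_cons], fun A _ => ⟨(hmA _ (convex_hullPow s A)).1, ?_⟩⟩
      refine Subset.trans (powList_mono k' ?_) (hmA _ (convex_hullPow s A)).2
      have := hullPow_mul_subset hs (s' / s) A
      rwa [mul_div_cancel₀ _ hs.ne'] at this
    rcases l with _ | ⟨s, k⟩
    · exact ⟨l', hl', h.symm, fun A hA => ⟨nil_case l' hl' h.symm A hA, subset_rfl⟩⟩
    rcases l' with _ | ⟨s', k'⟩
    · exact ⟨s :: k, hl, rfl, fun A hA => ⟨subset_rfl, nil_case _ hl h A hA⟩⟩
    simp only [List.length_cons] at hn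
    rcases hS.div_mem_or (hl' s' List.mem_cons_self) (hl s List.mem_cons_self) with hd | hd
    · exact cons_case s s' k k' hl hl' h (by omega) hd
    · obtain ⟨m, hm, hmp, hmA⟩ := cons_case s' s k' k hl' hl h.symm (by omega) hd
      exact ⟨m, hm, hmp.trans h.symm, fun A hA => (hmA A hA).symm⟩

/-- A list whose product is `p * q` can be refined so as to split at `p`. -/
theorem exists_split (hS : IsExponentRange S) {p q : ℝ} (hp : p ∈ S) (hq : q ∈ S)
    (hl : ∀ s ∈ l, s ∈ S) (h : l.prod = p * q) :
    ∃ l₁ l₂ : List ℝ, (∀ s ∈ l₁, s ∈ S) ∧ (∀ s ∈ l₂, s ∈ S) ∧ l₁.prod = p ∧ l₂.prod = q ∧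
      ∀ A : Set E, powList l A ⊆ powList l₂ (powList l₁ A) := by
  induction l generalizing p with
  | nil =>
    rw [List.prod_nil] at h
    have h1 := hS.eq_one_of_mul_eq_one hp hq h.symm
    refine ⟨[], [], by simp, by simp, h1.symm, ?_, fun A => subset_rfl⟩
    rw [h1, one_mul] at h
    exact h
  | cons s k ih =>
    rw [List.forall_mem_cons] at hl
    rw [List.prod_cons] at h
    have hs := hS.pos hl.1
    have hp0 := hS.pos hp
    rcases hS.div_mem_or hl.1 hp with hd | hd
    -- The head already passes p and is split there; in the other case the head stays and the tail
    -- is split at p / s.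
    · refine ⟨[p], s / p :: k, by simpa using hp, List.forall_mem_cons.2 ⟨hd, hl.2⟩, by simp,
        ?_, fun A => powList_mono k ?_⟩
      · rw [List.prod_cons]
        field_simp
        linarith
      · have := hullPow_mul_subset hp0 (s / p) A
        rwa [mul_div_cancel₀ _ hp0.ne'] at this
    · obtain ⟨l₁, l₂, h1, h2, h3, h4, h5⟩ := ih hd hl.2 (by field_simp; linarith)
      refine ⟨s :: l₁, l₂, List.forall_mem_cons.2 ⟨hl.1, h1⟩, h2, ?_, h4, fun A => h5 _⟩
      rw [List.prod_cons, h3, mul_div_cancel₀ _ hs.ne']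

end PowList

/-! ### The closed union of all composites, and the semigroup law -/

section RangePow

variable {E : Type*} [NormedAddCommGroup E] [NormedSpace ℝ E] {S : Set ℝ} {A B : Set E}
  {M p q c : ℝ}

theorem IsClosed.subset_of_forall_subset_smul (hA : IsClosed A)
    (h : ∀ c : ℝ, 1 < c → B ⊆ c • A) : B ⊆ A := by
  intro x hx
  have hlim : Filter.Tendsto (fun c : ℝ => c⁻¹ • x) (nhdsWithin 1 (Ioi 1)) (nhds x) := by
    have : ContinuousAt (fun c : ℝ => c⁻¹ • x) 1 :=
      (continuousAt_inv₀ one_ne_zero).smul continuousAt_const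
    simpa [ContinuousAt] using this.tendsto.mono_left nhdsWithin_le_nhds
  refine hA.mem_of_tendsto hlim ?_
  filter_upwards [self_mem_nhdsWithin] with c hc
  exact (mem_smul_set_iff_inv_smul_mem₀ (one_pos.trans hc).ne' _ _).1 (h c hc hx)

/-- The closure of the union of all composite powers with exponents in `S` of product `p`. -/
noncomputable def rangePow (S : Set ℝ) (p : ℝ) (A : Set E) : Set E :=
  closure (⋃ l ∈ {l : List ℝ | (∀ s ∈ l, s ∈ S) ∧ l.prod = p}, powList l A)

theorem powList_subset_rangePow {l : List ℝ} (hl : ∀ s ∈ l, s ∈ S) (A : Set E) :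
    powList l A ⊆ rangePow S l.prod A :=
  Subset.trans (subset_biUnion_of_mem (u := fun l => powList l A)
    (show l ∈ {k : List ℝ | (∀ s ∈ k, s ∈ S) ∧ k.prod = l.prod} from ⟨hl, rfl⟩)) subset_closure

theorem rangePow_subset {C : Set E} (hC : IsClosed C)
    (h : ∀ l : List ℝ, (∀ s ∈ l, s ∈ S) → l.prod = p → powList l A ⊆ C) :
    rangePow S p A ⊆ C :=
  closure_minimal (iUnion₂_subset fun l hl => h l hl.1 hl.2) hC

theorem isClosed_rangePow (S : Set ℝ) (p : ℝ) (A : Set E) : IsClosed (rangePow S p A) :=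
  isClosed_closure

theorem rangePow_mono (h : A ⊆ B) : rangePow S p A ⊆ rangePow S p B :=
  rangePow_subset (isClosed_rangePow _ _ _) fun l hl hp =>
    (powList_mono l h).trans (hp ▸ powList_subset_rangePow hl B)

theorem rangePow_smul_subset (hc : 0 < c) : rangePow S p (c • A) ⊆ c ^ p • rangePow S p A := by
  refine rangePow_subset ((isClosed_rangePow S p A).smul₀ (c ^ p)) fun l hl hp => ?_
  rw [powList_smul l hc, hp]
  exact smul_set_mono (hp ▸ powList_subset_rangePow hl A)

theorem rangePow_smul (hc : 0 < c) : rangePow S p (c • A) = c ^ p • rangePow S p A := by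
  refine (rangePow_smul_subset hc).antisymm ?_
  -- The reverse inclusion is the forward one for the factor c⁻¹ and the set c • A.
  have h := rangePow_smul_subset (S := S) (p := p) (A := c • A) (inv_pos.2 hc)
  rw [inv_smul_smul₀ hc.ne', Real.inv_rpow hc.le] at h
  exact (smul_set_subset_iff₀ (by positivity : c ^ p ≠ 0)).2 h

theorem Pinched.rangePow (h : Pinched M A) (hS : IsExponentRange S) (hp : p ∈ S) :
    Pinched (M ^ p) (rangePow S p A) := by
  refine ⟨h.one_le_rpow (hS.pos hp).le, ?_, ?_⟩
  · have h1 : ∀ s ∈ [p], s ∈ S := by simpa using hp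
    have h2 := powList_subset_rangePow h1 A
    have h3 := h.powList fun s hs => hS.pos (h1 s hs)
    rw [List.prod_singleton] at h2 h3
    exact h3.ball_subset.trans h2
  · exact rangePow_subset isClosed_closedBall fun l hl hlp =>
      hlp ▸ (h.powList fun s hs => hS.pos (hl s hs)).subset_ball

theorem Pinched.rangePow_subset_smul (hS : IsExponentRange S) (h : Pinched M A)
    (hA : Convex ℝ A) (hcl : IsClosed A) : _root_.rangePow S p A ⊆ M ^ |p - 1| • A :=
  rangePow_subset (hcl.smul₀ _) fun _ hl hlp => hlp ▸ h.powList_subset_smul hS hA hl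

theorem Pinched.subset_smul_rangePow (hS : IsExponentRange S) (h : Pinched M A)
    (hA : Convex ℝ A) (hp : p ∈ S) : A ⊆ M ^ |p - 1| • _root_.rangePow S p A := by
  have h1 : ∀ s ∈ [p], s ∈ S := by simpa using hp
  have h2 := powList_subset_rangePow h1 A
  have h3 := h.subset_smul_powList hA fun s hs => hS.pos (h1 s hs)
  rw [List.prod_singleton] at h2 h3
  exact h3.trans (smul_set_mono h2)

/-- The dilation bound M ^ |p - 1| is trivial at p = 1. -/
theorem rangePow_one (hS : IsExponentRange S) (hA : IsOriginBody A) : rangePow S 1 A = A := by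
  obtain ⟨M, hM⟩ := hA.exists_pinched
  apply Subset.antisymm
  · simpa using hM.rangePow_subset_smul (p := 1) hS hA.convex hA.isCompact.isClosed
  · simpa using hM.subset_smul_rangePow hS hA.convex hS.one_mem

theorem directed_powList (hS : IsExponentRange S) (hA : Convex ℝ A) :
    DirectedOn (fun l m => powList l A ⊆ powList m A)
      {l : List ℝ | (∀ s ∈ l, s ∈ S) ∧ l.prod = p} := by
  rintro l ⟨hl, hlp⟩ l' ⟨hl', hlp'⟩
  obtain ⟨m, hm, hmp, h⟩ := exists_common_refinement (E := E) hS l l' hl hl' (hlp.trans hlp'.symm)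
  exact ⟨m, ⟨hm, hmp.trans hlp⟩, (h A hA).1, (h A hA).2⟩

variable [FiniteDimensional ℝ E]

theorem IsOriginBody.rangePow (hA : IsOriginBody A) (hS : IsExponentRange S) (hp : p ∈ S) :
    IsOriginBody (rangePow S p A) := by
  obtain ⟨M, hM⟩ := hA.exists_pinched
  refine ⟨?_, ?_, (hM.rangePow hS hp).zero_mem_interior⟩
  · refine Convex.closure ?_
    intro x hx y hy a b ha hb hab
    simp only [mem_iUnion₂] at hx hy ⊢
    obtain ⟨l, hl, hxl⟩ := hx
    obtain ⟨l', hl', hyl⟩ := hy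
    obtain ⟨m, hm, h1, h2⟩ := directed_powList hS hA.convex l hl l' hl'
    exact ⟨m, hm, (hA.powList fun s hs => hS.pos (hm.1 s hs)).convex (h1 hxl) (h2 hyl) ha hb hab⟩
  · exact isCompact_of_isClosed_isBounded (isClosed_rangePow S p A)
      (isBounded_closedBall.subset (hM.rangePow hS hp).subset_ball)

/-- The closure of the union is approximated up to dilation by a single composite power. -/
theorem IsOriginBody.exists_rangePow_subset_smul_powList (hA : IsOriginBody A)
    (hS : IsExponentRange S) (hp : p ∈ S) (hc : 1 < c) :
    ∃ l : List ℝ, (∀ s ∈ l, s ∈ S) ∧ l.prod = p ∧ _root_.rangePow S p A ⊆ c • _root_.powList l A := by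
  obtain ⟨M, hM⟩ := hA.exists_pinched
  set I := {l : List ℝ | (∀ s ∈ l, s ∈ S) ∧ l.prod = p} with hI
  have hIne : I.Nonempty := ⟨[p], by simpa using hp, by simp⟩
  -- Every composite of product p contains the ball of radius (M ^ p)⁻¹, so thickening it by r stays
  -- inside its dilate by c.
  set r := (c - 1) * (M ^ p)⁻¹ with hr
  have hMp := (hM.rangePow hS hp).pos
  have hr0 : 0 < r := mul_pos (by linarith) (inv_pos.2 hMp)
  have hcompact := (hA.rangePow hS hp).isCompact
  have hcover : _root_.rangePow S p A ⊆ ⋃ l : I, _root_.powList l.1 A + ball 0 r := by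
    intro x hx
    obtain ⟨y, hy, hxy⟩ := Metric.mem_closure_iff.1 hx r hr0
    simp only [mem_iUnion₂] at hy
    obtain ⟨l, hl, hyl⟩ := hy
    exact mem_iUnion.2 ⟨⟨l, hl⟩, y, hyl, x - y, by simpa [dist_eq_norm] using hxy, by simp⟩
  -- The thickened composites form a directed open cover of a compact set, so one of them covers.
  have hdir : Directed (· ⊆ ·) fun l : I => _root_.powList l.1 A + ball (0 : E) r := by
    rintro ⟨l, hl⟩ ⟨l', hl'⟩
    obtain ⟨m, hm, h1, h2⟩ := directed_powList hS hA.convex l hl l' hl'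
    exact ⟨⟨m, hm⟩, add_subset_add_right h1, add_subset_add_right h2⟩
  have : Nonempty I := hIne.to_subtype
  obtain ⟨⟨l, hl⟩, hsub⟩ := hcompact.elim_directed_cover _
    (fun _ => IsOpen.add_left isOpen_ball) hcover hdir
  refine ⟨l, hl.1, hl.2, hsub.trans ?_⟩
  have hl0 : ∀ s ∈ l, 0 < s := fun s hs => hS.pos (hl.1 s hs)
  have hball : ball (0 : E) r ⊆ (c - 1) • _root_.powList l A := by
    have h1 := (hM.powList hl0).ball_subset
    rw [hl.2] at h1
    refine Subset.trans ?_ (smul_set_mono h1)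
    rw [smul_closedBall _ _ (inv_pos.2 hMp).le, smul_zero, Real.norm_of_nonneg (by linarith)]
    exact ball_subset_closedBall
  calc _root_.powList l A + ball (0 : E) r
      ⊆ (1 : ℝ) • _root_.powList l A + (c - 1) • _root_.powList l A := by
        rw [one_smul]
        exact add_subset_add_left hball
    _ = c • _root_.powList l A := by
        rw [← (hA.powList hl0).convex.add_smul zero_le_one (by linarith), add_sub_cancel]

/-- One inclusion replaces the inner power by a single composite up to the factor c ^ q⁻¹; an outer
composite of product q turns this into c, and c → 1 by closedness. The other splits each list of
product p * q at p. -/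
theorem IsOriginBody.rangePow_rangePow (hA : IsOriginBody A) (hS : IsExponentRange S)
    (hp : p ∈ S) (hq : q ∈ S) :
    _root_.rangePow S q (_root_.rangePow S p A) = _root_.rangePow S (p * q) A := by
  apply Subset.antisymm
  · refine rangePow_subset (isClosed_rangePow _ _ _) fun m hm hmq => ?_
    refine (isClosed_rangePow _ _ _).subset_of_forall_subset_smul fun c hc => ?_
    have hq0 := hS.pos hq
    have hc0 : 0 < c := by linarith
    obtain ⟨l, hl, hlp, hsub⟩ := hA.exists_rangePow_subset_smul_powList hS hp
      (Real.one_lt_rpow hc (inv_pos.2 hq0))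
    have h := powList_mono m hsub
    rw [powList_smul m (by positivity), ← powList_append, hmq,
      Real.rpow_inv_rpow hc0.le hq0.ne'] at h
    refine h.trans (smul_set_mono ?_)
    have hlm : ∀ s ∈ l ++ m, s ∈ S := fun s hs => (List.mem_append.1 hs).elim (hl s) (hm s)
    have := powList_subset_rangePow hlm A
    rwa [List.prod_append, hlp, hmq] at this
  · refine rangePow_subset (isClosed_rangePow _ _ _) fun l hl hlp => ?_
    obtain ⟨l₁, l₂, h1, h2, h3, h4, h5⟩ := exists_split (E := E) hS hp hq hl hlp
    refine (h5 A).trans ?_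
    rw [← h3, ← h4]
    exact (powList_mono l₂ (powList_subset_rangePow h1 A)).trans (powList_subset_rangePow h2 _)

end RangePow

/-! ### Convergence along fine lists -/

theorem exists_pos_rpow_le {M c : ℝ} (hM : 1 ≤ M) (hc : 1 < c) : ∃ δ : ℝ, 0 < δ ∧ M ^ δ ≤ c := by
  have hδ : 0 < Real.logb (M + 1) c := Real.logb_pos (by linarith) hc
  refine ⟨Real.logb (M + 1) c, hδ, ?_⟩
  calc M ^ Real.logb (M + 1) c ≤ (M + 1) ^ Real.logb (M + 1) c :=
        Real.rpow_le_rpow (by linarith) (by linarith) hδ.le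
    _ = c := Real.rpow_logb (by linarith) (by linarith) (by linarith)

/-- The partial products of a list with small steps come close to every value they pass. -/
theorem exists_prefix_prod_near {S : Set ℝ} (hS : IsExponentRange S) {l : List ℝ} {x δ : ℝ}
    (hx : x ∈ S) (hl : ∀ s ∈ l, s ∈ S) (hδ : ∀ s ∈ l, |s - 1| ≤ δ * s) :
    (∃ l₁ l₂ : List ℝ, l = l₁ ++ l₂ ∧ |l₁.prod - x| ≤ δ * x) ∨ x / l.prod ∈ S := by
  induction l generalizing x with
  | nil => exact Or.inr (by simpa using hx)
  | cons s l ih =>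
    rw [List.forall_mem_cons] at hl hδ
    have hs := hS.pos hl.1
    rcases hS.div_mem_or hx hl.1 with hd | hd
    · rcases ih hd hl.2 hδ.2 with ⟨l₁, l₂, rfl, h⟩ | h
      · refine Or.inl ⟨s :: l₁, l₂, rfl, ?_⟩
        have h1 : |(s :: l₁).prod - x| = s * |l₁.prod - x / s| := by
          rw [List.prod_cons, ← abs_of_pos hs, ← abs_mul, abs_of_pos hs]
          congr 1
          field_simp
        have h2 : δ * x = s * (δ * (x / s)) := by field_simp
        rw [h1, h2]
        gcongr
      · right
        rwa [List.prod_cons, ← div_div]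
    -- The head reaches or passes x, so x lies between 1 and s, and the empty prefix, of product 1,
    -- is already close enough.
    · refine Or.inl ⟨[], s :: l, rfl, ?_⟩
      rw [List.prod_nil]
      have h1 := hδ.1
      have hx0 := hS.pos hx
      rcases hS with rfl | rfl
      · have hsx : s ≤ x := (div_le_one hx0).1 hd.2
        rw [abs_of_nonpos (by linarith [hl.1.2])] at h1
        rw [abs_of_nonneg (by linarith [hx.2])]
        nlinarith
      · have hxs : x ≤ s := (one_le_div hx0).1 hd
        have h1x : 1 ≤ x := hx
        rw [abs_of_nonneg (by linarith)] at h1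
        rw [abs_of_nonpos (by linarith)]
        have : (1 - δ) * s ≤ 1 := by linarith
        rcases le_total 0 (1 - δ) with h | h <;> nlinarith

/-- If the list stops before passing x, then x lies between its product and x * p, which are
δ-close, so the whole list serves as prefix. -/
theorem exists_prefix_prod_near_of_near {S : Set ℝ} (hS : IsExponentRange S) {l : List ℝ}
    {x p δ : ℝ} (hx : x ∈ S) (hp : p ∈ S) (hδ0 : 0 ≤ δ) (hl : ∀ s ∈ l, s ∈ S)
    (hδ : ∀ s ∈ l, |s - 1| ≤ δ * s) (h : |l.prod - x * p| ≤ δ) :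
    ∃ l₁ l₂ : List ℝ, l = l₁ ++ l₂ ∧ |l₁.prod - x| ≤ δ * (1 + x) := by
  have hx0 := hS.pos hx
  rcases exists_prefix_prod_near hS hx hl hδ with ⟨l₁, l₂, rfl, h1⟩ | h1
  · exact ⟨l₁, l₂, rfl, h1.trans (by nlinarith)⟩
  · refine ⟨l, [], by simp, ?_⟩
    have hl0 := hS.pos (hS.prod_mem hl)
    have hδx := mul_nonneg hδ0 hx0.le
    refine le_trans ?_ (h.trans (by linarith))
    rcases hS with rfl | rfl
    · have h2 : x ≤ l.prod := (div_le_one hl0).1 h1.2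
      have h3 : x * p ≤ x := mul_le_of_le_one_right hx0.le hp.2
      rw [abs_of_nonneg (by linarith), abs_of_nonneg (by linarith)]
      linarith
    · have h2 : l.prod ≤ x := (one_le_div hl0).1 h1
      have h3 : x ≤ x * p := le_mul_of_one_le_right hx0.le hp
      rw [abs_of_nonpos (by linarith), abs_of_nonpos (by linarith)]
      linarith

section

variable {E : Type*} [NormedAddCommGroup E] [NormedSpace ℝ E] {S : Set ℝ} {A : Set E}

theorem convex_powList (l : List ℝ) (hA : Convex ℝ A) : Convex ℝ (powList l A) := by
  induction l generalizing A with
  | nil => exact hA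
  | cons s l ih => exact ih (convex_hullPow s A)

/-- Composite powers along fine lists dominate, up to dilation, a given composite power. -/
theorem exists_mesh_powList_subset (hS : IsExponentRange S) (k : List ℝ) (hk : ∀ s ∈ k, s ∈ S)
    {M c : ℝ} (hM : 1 ≤ M) (hc : 1 < c) :
    ∃ δ : ℝ, 0 < δ ∧ ∀ A : Set E, Convex ℝ A → Pinched M A → ∀ l : List ℝ, (∀ s ∈ l, s ∈ S) →
      (∀ s ∈ l, |s - 1| ≤ δ * s) → |l.prod - k.prod| ≤ δ → powList k A ⊆ c • powList l A := by
  -- The product of l is allowed an error δ because the tail left after cutting l near x has only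
  -- approximately the product of the tail of k.
  induction k generalizing M c with
  | nil =>
    obtain ⟨δ, hδ, hle⟩ := exists_pos_rpow_le hM hc
    refine ⟨δ, hδ, fun A hA hMA l hl _ hprod => ?_⟩
    have hl0 : ∀ s ∈ l, 0 < s := fun s hs => hS.pos (hl s hs)
    have hstar := (convex_powList l hA).starConvex
      (interior_subset (hMA.powList hl0).zero_mem_interior)
    refine (hMA.subset_smul_powList hA hl0).trans (hstar.smul_subset_smul (by positivity) ?_)
    rw [List.prod_nil] at hprod
    exact (Real.rpow_le_rpow_of_exponent_le hM hprod).trans hle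
  | cons x k ih =>
    rw [List.forall_mem_cons] at hk
    have hx := hS.pos hk.1
    have hkp := hS.prod_mem hk.2
    have hp := hS.pos hkp
    set p := k.prod with hp_def
    have hc' : 1 < √c := Real.lt_sqrt_of_sq_lt (by simpa using hc)
    obtain ⟨δ₁, hδ₁, h1⟩ := ih hk.2 (Real.one_le_rpow hM hx.le) hc'
    obtain ⟨δ₂, hδ₂, h2⟩ := exists_pos_rpow_le hM hc'
    -- With t and u the products of the two pieces of l, the conditions ensure in turn t ≥ x / 2, |u
    -- - p| ≤ δ₁, |u - p| ≤ 1, |x - t| * u ≤ δ₂, and a mesh fine enough for the induction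
    -- hypothesis.
    obtain ⟨δ, hδ, ha, hb, hb1, hd, he⟩ : ∃ δ : ℝ, 0 < δ ∧ δ * (1 + x) ≤ x / 2 ∧
        δ * (1 + p * (1 + x)) ≤ δ₁ * (x / 2) ∧ δ * (1 + p * (1 + x)) ≤ 1 * (x / 2) ∧
        δ * (1 + x) * (p + 1) ≤ δ₂ ∧ δ ≤ δ₁ := by
      refine ⟨min (min (min (x / 2 / (1 + x)) (δ₁ * (x / 2) / (1 + p * (1 + x))))
        (min (1 * (x / 2) / (1 + p * (1 + x))) (δ₂ / ((1 + x) * (p + 1))))) δ₁, ?_, ?_, ?_, ?_,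
        ?_, min_le_right _ _⟩
      · positivity
      · rw [← le_div_iff₀ (by positivity)]
        exact (min_le_left _ _).trans ((min_le_left _ _).trans (min_le_left _ _))
      · rw [← le_div_iff₀ (by positivity)]
        exact (min_le_left _ _).trans ((min_le_left _ _).trans (min_le_right _ _))
      · rw [← le_div_iff₀ (by positivity)]
        exact (min_le_left _ _).trans ((min_le_right _ _).trans (min_le_left _ _))
      · rw [mul_assoc, ← le_div_iff₀ (by positivity)]
        exact (min_le_left _ _).trans ((min_le_right _ _).trans (min_le_right _ _))
    refine ⟨δ, hδ, fun A hA hMA l hl hlδ hprod => ?_⟩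
    rw [List.prod_cons] at hprod
    obtain ⟨l₁, l₂, rfl, hnear⟩ := exists_prefix_prod_near_of_near hS hk.1 hkp hδ.le hl hlδ hprod
    simp only [List.forall_mem_append] at hl hlδ
    rw [List.prod_append] at hprod
    have hl₁ : ∀ s ∈ l₁, 0 < s := fun s hs => hS.pos (hl.1 s hs)
    have hl₂ : ∀ s ∈ l₂, 0 < s := fun s hs => hS.pos (hl.2 s hs)
    have ht := List.prod_pos hl₁
    have hu := List.prod_pos hl₂
    set t := l₁.prod
    set u := l₂.prod
    have ht2 : x / 2 ≤ t := by linarith [(abs_le.1 (hnear.trans ha)).1]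
    have hup : |u - p| * (x / 2) ≤ δ * (1 + p * (1 + x)) := by
      calc |u - p| * (x / 2) ≤ |u - p| * t := by gcongr
        _ = |(t * u - x * p) - p * (t - x)| := by
          rw [← abs_of_pos ht, ← abs_mul, abs_of_pos ht]; congr 1; ring
        _ ≤ |t * u - x * p| + |p * (t - x)| := abs_sub _ _
        _ ≤ δ + p * (δ * (1 + x)) := by
          rw [abs_mul, abs_of_pos hp]; gcongr
        _ = δ * (1 + p * (1 + x)) := by ring
    have hu1 : |u - p| ≤ δ₁ := le_of_mul_le_mul_right (hup.trans hb) (by positivity)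
    have hu2 : |u - p| ≤ 1 := le_of_mul_le_mul_right (hup.trans hb1) (by positivity)
    have hup1 : u ≤ p + 1 := by linarith [(abs_le.1 hu2).2]
    have hstep : powList k (hullPow x A) ⊆ √c • powList l₂ (hullPow x A) :=
      h1 _ (convex_hullPow x A) (hMA.hullPow hx) l₂ hl.2
        (fun s hs => (hlδ.2 s hs).trans (by have := hl₂ s hs; gcongr)) hu1
    have h0 : (0 : E) ∈ A := interior_subset hMA.zero_mem_interior
    -- Exponent x is moved to t at the cost of a dilation, and the single power t lies in the
    -- composite along l₁.
    have hfirst : hullPow x A ⊆ M ^ |x - t| • powList l₁ A :=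
      (hMA.hullPow_subset_smul (hA.starConvex h0) hx ht).trans
        (smul_set_mono (hullPow_prod_subset_powList hA hl₁))
    have hM0 := hMA.pos
    have hsecond := powList_mono l₂ hfirst
    rw [powList_smul l₂ (by positivity), ← Real.rpow_mul hM0.le, ← powList_append] at hsecond
    have hstar : StarConvex ℝ 0 (powList (l₁ ++ l₂) A) := (convex_powList _ hA).starConvex
      (interior_subset (hMA.powList (List.forall_mem_append.2 ⟨hl₁, hl₂⟩)).zero_mem_interior)
    have hexp : M ^ (|x - t| * l₂.prod) ≤ √c := by
      refine le_trans (Real.rpow_le_rpow_of_exponent_le hM ?_) h2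
      refine le_trans ?_ hd
      rw [abs_sub_comm]
      gcongr
    calc powList (x :: k) A ⊆ √c • powList l₂ (hullPow x A) := hstep
      _ ⊆ √c • √c • powList (l₁ ++ l₂) A :=
        smul_set_mono (hsecond.trans (hstar.smul_subset_smul (by positivity) hexp))
      _ = c • powList (l₁ ++ l₂) A := by
        rw [smul_smul, Real.mul_self_sqrt (by linarith)]

theorem IsOriginBody.exists_mesh_rangePow_subset [FiniteDimensional ℝ E] (hA : IsOriginBody A)
    (hS : IsExponentRange S) {p c : ℝ} (hp : p ∈ S) (hc : 1 < c) :
    ∃ δ : ℝ, 0 < δ ∧ ∀ l : List ℝ, (∀ s ∈ l, s ∈ S) → l.prod = p →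
      (∀ s ∈ l, |s - 1| ≤ δ * s) → _root_.rangePow S p A ⊆ c • _root_.powList l A := by
  obtain ⟨M, hM⟩ := hA.exists_pinched
  have hc' : 1 < √c := Real.lt_sqrt_of_sq_lt (by simpa using hc)
  obtain ⟨k, hk, hkp, hsub⟩ := hA.exists_rangePow_subset_smul_powList hS hp hc'
  obtain ⟨δ, hδ, h⟩ := exists_mesh_powList_subset (E := E) hS k hk hM.one_le hc'
  refine ⟨δ, hδ, fun l hl hlp hlδ => hsub.trans ?_⟩
  have := h A hA.convex hM l hl hlδ (by rw [hlp, hkp, sub_self, abs_zero]; exact hδ.le)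
  calc √c • _root_.powList k A ⊆ √c • √c • _root_.powList l A := smul_set_mono this
    _ = c • _root_.powList l A := by rw [smul_smul, Real.mul_self_sqrt (by linarith)]

end

/-! ### Partitions as lists of exponents -/

/-- The exponents of `lowerIterate t m`, in the order of application. -/
noncomputable def lowerList (t : ℕ → ℝ) : ℕ → List ℝ
  | 0 => []
  | m + 1 => (t m / t (m + 1)) :: lowerList t m

/-- The exponents of `upperIterate t m`, in the order of application. -/
noncomputable def upperList (t : ℕ → ℝ) : ℕ → List ℝ
  | 0 => []
  | m + 1 => upperList t m ++ [t (m + 1) / t m]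

theorem mem_lowerList {t : ℕ → ℝ} {m : ℕ} {s : ℝ} (h : s ∈ lowerList t m) :
    ∃ i < m, s = t i / t (i + 1) := by
  induction m with
  | zero => simp [lowerList] at h
  | succ m ih =>
    rcases List.mem_cons.1 h with rfl | h
    · exact ⟨m, by omega, rfl⟩
    · obtain ⟨i, hi, rfl⟩ := ih h
      exact ⟨i, by omega, rfl⟩

theorem mem_upperList {t : ℕ → ℝ} {m : ℕ} {s : ℝ} (h : s ∈ upperList t m) :
    ∃ i < m, s = t (i + 1) / t i := by
  induction m with
  | zero => simp [upperList] at h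
  | succ m ih =>
    rcases List.mem_append.1 h with h | h
    · obtain ⟨i, hi, rfl⟩ := ih h
      exact ⟨i, by omega, rfl⟩
    · exact ⟨m, by omega, List.mem_singleton.1 h⟩

theorem prod_lowerList {t : ℕ → ℝ} {m : ℕ} (h : ∀ i ≤ m, 0 < t i) :
    (lowerList t m).prod = t 0 / t m := by
  induction m with
  | zero => rw [lowerList, List.prod_nil, div_self (h 0 le_rfl).ne']
  | succ m ih =>
    have := h m (by omega)
    rw [lowerList, List.prod_cons, ih fun i hi => h i (by omega)]
    field_simp

theorem prod_upperList {t : ℕ → ℝ} {m : ℕ} (h : ∀ i ≤ m, 0 < t i) :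
    (upperList t m).prod = t m / t 0 := by
  induction m with
  | zero => rw [upperList, List.prod_nil, div_self (h 0 le_rfl).ne']
  | succ m ih =>
    have := h m (by omega)
    rw [upperList, List.prod_append, List.prod_singleton, ih fun i hi => h i (by omega)]
    field_simp

theorem lowerList_congr {t t' : ℕ → ℝ} {m : ℕ} (h : ∀ i ≤ m, t i = t' i) :
    lowerList t m = lowerList t' m := by
  induction m with
  | zero => rfl
  | succ m ih =>
    rw [lowerList, lowerList, ih fun i hi => h i (by omega), h m (by omega), h (m + 1) le_rfl]

theorem upperList_congr {t t' : ℕ → ℝ} {m : ℕ} (h : ∀ i ≤ m, t i = t' i) :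
    upperList t m = upperList t' m := by
  induction m with
  | zero => rfl
  | succ m ih =>
    rw [upperList, upperList, ih fun i hi => h i (by omega), h m (by omega), h (m + 1) le_rfl]

section

variable {n : ℕ} {K : Set (Euc n)}

theorem IsOriginBody.lowerIterate_eq (hK : IsOriginBody K) {t : ℕ → ℝ} {m : ℕ}
    (h : ∀ i ≤ m, 0 < t i) : lowerIterate t m K = _root_.powList (lowerList t m) K := by
  induction m generalizing K with
  | zero => rfl
  | succ m ih =>
    have hs : 0 < t m / t (m + 1) := div_pos (h m (by omega)) (h (m + 1) le_rfl)
    rw [lowerIterate, hK.naivePower_eq hs, ih (hK.hullPow hs) fun i hi => h i (by omega)]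
    rfl

theorem IsOriginBody.upperIterate_eq (hK : IsOriginBody K) {t : ℕ → ℝ} {m : ℕ}
    (h : ∀ i ≤ m, 0 < t i) : upperIterate t m K = _root_.powList (upperList t m) K := by
  induction m with
  | zero => rfl
  | succ m ih =>
    have hs : 0 < t (m + 1) / t m := div_pos (h (m + 1) le_rfl) (h m (by omega))
    have h' : ∀ i ≤ m, 0 < t i := fun i hi => h i (by omega)
    have hl : ∀ s ∈ upperList t m, 0 < s := by
      intro s hs
      obtain ⟨i, hi, rfl⟩ := mem_upperList hs
      exact div_pos (h' _ (by omega)) (h' _ (by omega))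
    rw [upperIterate, ih h', (hK.powList hl).naivePower_eq hs, upperList, powList_append]
    rfl

end

theorem IntervalPartition.le_apply {a b : ℝ} (Q : IntervalPartition a b) {i : ℕ} (hi : i ≤ Q.m) :
    a ≤ Q.t i := by
  induction i with
  | zero => exact Q.t_first.ge
  | succ i ih => exact (ih (by omega)).trans (Q.t_lt i (by omega)).le

/-- The head of the list is the ratio of the topmost interval, so the tail comes from a partition
ending at a * s; this is why the right end a is free. -/
theorem exists_lowerList_eq {l : List ℝ} (hl : ∀ s ∈ l, s ∈ Ioo (0 : ℝ) 1) {a : ℝ} (ha : 0 < a) :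
    ∃ (m : ℕ) (t : ℕ → ℝ), t 0 = a * l.prod ∧ t m = a ∧ (∀ i < m, t i < t (i + 1)) ∧
      lowerList t m = l := by
  induction l generalizing a with
  | nil => exact ⟨0, fun _ => a, by simp, rfl, by simp, rfl⟩
  | cons s l ih =>
    rw [List.forall_mem_cons] at hl
    obtain ⟨m, t, h0, hm, hlt, hlist⟩ := ih hl.2 (mul_pos ha hl.1.1)
    have hle : ∀ i ≤ m, (fun i => if i ≤ m then t i else a) i = t i := fun i hi => if_pos hi
    refine ⟨m + 1, fun i => if i ≤ m then t i else a, ?_, ?_, ?_, ?_⟩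
    · rw [hle 0 (by omega), h0, List.prod_cons, mul_assoc]
    · exact if_neg (by omega)
    · intro i hi
      rw [hle i (by omega)]
      rcases (Nat.lt_succ_iff.1 hi).eq_or_lt with rfl | hi
      · simp only [Nat.not_succ_le_self, if_false, hm]
        exact mul_lt_of_lt_one_right ha hl.1.2
      · rw [hle (i + 1) hi]
        exact hlt i hi
    · rw [lowerList, lowerList_congr hle, hlist]
      simp only [le_refl, if_true, Nat.not_succ_le_self, if_false, hm]
      rw [mul_div_cancel_left₀ _ ha.ne']

theorem exists_upperList_eq {l : List ℝ} (hl : ∀ s ∈ l, s ∈ Ioi (1 : ℝ)) :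
    ∃ (m : ℕ) (t : ℕ → ℝ), t 0 = 1 ∧ t m = l.prod ∧ (∀ i < m, t i < t (i + 1)) ∧
      upperList t m = l := by
  induction l using List.reverseRecOn with
  | nil => exact ⟨0, fun _ => 1, by simp, by simp, by simp, rfl⟩
  | append_singleton l s ih =>
    simp only [List.forall_mem_append, List.forall_mem_singleton] at hl
    obtain ⟨m, t, h0, hm, hlt, hlist⟩ := ih hl.1
    have hle : ∀ i ≤ m, (fun i => if i ≤ m then t i else l.prod * s) i = t i :=
      fun i hi => if_pos hi
    have hpos : 0 < l.prod := List.prod_pos fun r hr => one_pos.trans (hl.1 r hr)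
    refine ⟨m + 1, fun i => if i ≤ m then t i else l.prod * s, ?_, ?_, ?_, ?_⟩
    · rw [hle 0 (by omega), h0]
    · rw [List.prod_append, List.prod_singleton]
      exact if_neg (by omega)
    · intro i hi
      rw [hle i (by omega)]
      rcases (Nat.lt_succ_iff.1 hi).eq_or_lt with rfl | hi
      · simp only [Nat.not_succ_le_self, if_false, hm]
        exact lt_mul_of_one_lt_right hpos hl.2
      · rw [hle (i + 1) hi]
        exact hlt i hi
    · rw [upperList, upperList_congr hle, hlist]
      simp only [le_refl, if_true, Nat.not_succ_le_self, if_false, hm]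
      rw [mul_div_cancel_left₀ _ hpos.ne']

/-- Exponents equal to one can be dropped. -/
theorem exists_powList_eq_ne_one {E : Type*} [NormedAddCommGroup E] [NormedSpace ℝ E]
    (l : List ℝ) :
    ∃ k : List ℝ, (∀ s ∈ k, s ∈ l ∧ s ≠ 1) ∧ k.prod = l.prod ∧
      ∀ A : Set E, Convex ℝ A → powList l A = powList k A := by
  induction l with
  | nil => exact ⟨[], by simp, rfl, fun A _ => rfl⟩
  | cons s l ih =>
    obtain ⟨k, hk, hkp, h⟩ := ih
    rcases eq_or_ne s 1 with rfl | hs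
    · refine ⟨k, fun r hr => ⟨List.mem_cons_of_mem _ (hk r hr).1, (hk r hr).2⟩, by simp [hkp],
        fun A hA => ?_⟩
      rw [powList, hullPow_one hA, h A hA]
    · refine ⟨s :: k, ?_, by rw [List.prod_cons, List.prod_cons, hkp],
        fun A _ => h _ (convex_hullPow s A)⟩
      rw [List.forall_mem_cons]
      exact ⟨⟨List.mem_cons_self, hs⟩,
        fun r hr => ⟨List.mem_cons_of_mem _ (hk r hr).1, (hk r hr).2⟩⟩

section

variable {n : ℕ} {K : Set (Euc n)} {p : ℝ}

theorem IntervalPartition.lowerPower_eq (hp : 0 < p) (Q : IntervalPartition p 1)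
    (hK : IsOriginBody K) : lowerPower Q K = powList (lowerList Q.t Q.m) K :=
  hK.lowerIterate_eq fun _ hi => hp.trans_le (Q.le_apply hi)

theorem IntervalPartition.upperPower_eq (Q : IntervalPartition 1 p)
    (hK : IsOriginBody K) : upperPower Q K = powList (upperList Q.t Q.m) K :=
  hK.upperIterate_eq fun _ hi => one_pos.trans_le (Q.le_apply hi)

theorem IntervalPartition.lowerList_mem (hp : 0 < p) (Q : IntervalPartition p 1) :
    ∀ s ∈ lowerList Q.t Q.m, s ∈ Ioc (0 : ℝ) 1 := by
  intro s hs
  obtain ⟨i, hi, rfl⟩ := mem_lowerList hs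
  have h1 := hp.trans_le (Q.le_apply hi.le)
  have h2 := Q.t_lt i hi
  exact ⟨div_pos h1 (h1.trans h2), (div_le_one (h1.trans h2)).2 h2.le⟩

theorem IntervalPartition.upperList_mem (Q : IntervalPartition 1 p) :
    ∀ s ∈ upperList Q.t Q.m, s ∈ Ici (1 : ℝ) := by
  intro s hs
  obtain ⟨i, hi, rfl⟩ := mem_upperList hs
  exact (one_le_div (one_pos.trans_le (Q.le_apply hi.le))).2 (Q.t_lt i hi).le

theorem IntervalPartition.prod_lowerList (hp : 0 < p) (Q : IntervalPartition p 1) :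
    (lowerList Q.t Q.m).prod = p := by
  rw [_root_.prod_lowerList fun i hi => hp.trans_le (Q.le_apply hi), Q.t_first, Q.t_last, div_one]

theorem IntervalPartition.prod_upperList (Q : IntervalPartition 1 p) :
    (upperList Q.t Q.m).prod = p := by
  rw [_root_.prod_upperList fun i hi => one_pos.trans_le (Q.le_apply hi), Q.t_first, Q.t_last,
    div_one]

/-- The step is at most δ p / t_{i+1}, and p ≤ t_i; this accounts for the factor p in the mesh. -/
theorem IntervalPartition.lowerList_step (hp : 0 < p) (Q : IntervalPartition p 1) {δ : ℝ}
    (hδ : 0 < δ) (hQ : Q.MeshLT (δ * p)) : ∀ s ∈ lowerList Q.t Q.m, |s - 1| ≤ δ * s := by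
  intro s hs
  obtain ⟨i, hi, rfl⟩ := mem_lowerList hs
  have h1 := Q.le_apply hi.le
  have h2 := hp.trans_le (Q.le_apply (Nat.succ_le_of_lt hi))
  have h3 : Q.t i / Q.t (i + 1) - 1 = -((Q.t (i + 1) - Q.t i) / Q.t (i + 1)) := by
    field_simp
    ring
  rw [h3, abs_neg, abs_div, abs_of_pos h2, ← mul_div_assoc]
  gcongr
  exact (hQ i hi).le.trans (by gcongr)

theorem IntervalPartition.upperList_step (Q : IntervalPartition 1 p) {δ : ℝ}
    (hδ : 0 < δ) (hQ : Q.MeshLT δ) : ∀ s ∈ upperList Q.t Q.m, |s - 1| ≤ δ * s := by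
  intro s hs
  obtain ⟨i, hi, rfl⟩ := mem_upperList hs
  have h1 := Q.le_apply hi.le
  have h2 := Q.le_apply (Nat.succ_le_of_lt hi)
  have h0 : 0 < Q.t i := by linarith
  have h3 : Q.t (i + 1) / Q.t i - 1 = (Q.t (i + 1) - Q.t i) / Q.t i := by
    field_simp
  rw [h3, abs_div, abs_of_pos h0, ← mul_div_assoc]
  gcongr
  exact (hQ i hi).le.trans (le_mul_of_one_le_right hδ.le h2)

theorem isExponentRange_Ioc : IsExponentRange (Ioc 0 1) := Or.inl rfl

theorem isExponentRange_Ici : IsExponentRange (Ici 1) := Or.inr rfl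

/-- Partitions are strictly increasing while lists may contain the exponent 1; such entries act
trivially on convex sets and are dropped. -/
theorem IsOriginBody.iUnion_lowerPower (hK : IsOriginBody K) (hp : 0 < p) :
    ⋃ Q : IntervalPartition p 1, lowerPower Q K =
      ⋃ l ∈ {l : List ℝ | (∀ s ∈ l, s ∈ Ioc (0 : ℝ) 1) ∧ l.prod = p}, _root_.powList l K := by
  apply Subset.antisymm
  · refine iUnion_subset fun Q => ?_
    rw [Q.lowerPower_eq hp hK]
    exact subset_biUnion_of_mem (u := fun l => _root_.powList l K)
      ⟨Q.lowerList_mem hp, Q.prod_lowerList hp⟩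
  · refine iUnion₂_subset fun l hl => ?_
    obtain ⟨k, hk, hkp, h⟩ := exists_powList_eq_ne_one (E := Euc n) l
    obtain ⟨m, t, h0, hm, hlt, hlist⟩ := exists_lowerList_eq (l := k) (a := 1)
      (fun s hs => ⟨(hl.1 s (hk s hs).1).1, (hl.1 s (hk s hs).1).2.lt_of_ne (hk s hs).2⟩) one_pos
    let Q : IntervalPartition p 1 := ⟨m, t, by rw [h0, one_mul, hkp, hl.2], hm, hlt⟩
    rw [h K hK.convex, ← hlist]
    exact (Q.lowerPower_eq hp hK).ge.trans (subset_iUnion (fun Q => lowerPower Q K) Q)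

theorem IsOriginBody.iUnion_upperPower (hK : IsOriginBody K) :
    ⋃ Q : IntervalPartition 1 p, upperPower Q K =
      ⋃ l ∈ {l : List ℝ | (∀ s ∈ l, s ∈ Ici (1 : ℝ)) ∧ l.prod = p}, _root_.powList l K := by
  apply Subset.antisymm
  · refine iUnion_subset fun Q => ?_
    rw [Q.upperPower_eq hK]
    exact subset_biUnion_of_mem (u := fun l => _root_.powList l K)
      ⟨Q.upperList_mem, Q.prod_upperList⟩
  · refine iUnion₂_subset fun l hl => ?_
    obtain ⟨k, hk, hkp, h⟩ := exists_powList_eq_ne_one (E := Euc n) l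
    obtain ⟨m, t, h0, hm, hlt, hlist⟩ := exists_upperList_eq (l := k)
      (fun s hs => lt_of_le_of_ne (hl.1 s (hk s hs).1) (hk s hs).2.symm)
    let Q : IntervalPartition 1 p := ⟨m, t, h0, by rw [hm, hkp, hl.2], hlt⟩
    rw [h K hK.convex, ← hlist]
    exact (Q.upperPower_eq hK).ge.trans (subset_iUnion (fun Q => upperPower Q K) Q)

theorem IsOriginBody.powerSet_of_le_one (hK : IsOriginBody K) (hp : 0 < p) (hp1 : p ≤ 1) :
    powerSet p K = _root_.rangePow (Ioc 0 1) p K := by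
  rw [powerSet, if_neg hp.ne']
  split_ifs with h1 h2
  · rw [h1, rangePow_one isExponentRange_Ioc hK]
  · rw [hK.iUnion_lowerPower hp, _root_.rangePow]
  · exact absurd (hp1.lt_of_ne h1) h2

theorem IsOriginBody.powerSet_of_one_le (hK : IsOriginBody K) (hp1 : 1 ≤ p) :
    powerSet p K = _root_.rangePow (Ici 1) p K := by
  rw [powerSet, if_neg (by linarith)]
  split_ifs with h1 h2
  · rw [h1, rangePow_one isExponentRange_Ici hK]
  · linarith
  · rw [hK.iUnion_upperPower, _root_.rangePow]

end

/-! ### Hausdorff distance versus dilations -/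

theorem exists_dist_le_hausdorffDist {E : Type*} [NormedAddCommGroup E] {A B : Set E} (hA : IsCompact A) (hB : IsCompact B)
    (hBne : B.Nonempty) {x : E} (hx : x ∈ A) : ∃ y ∈ B, dist x y ≤ hausdorffDist A B := by
  obtain ⟨y, hy, h⟩ := hB.exists_infDist_eq_dist hBne x
  exact ⟨y, hy, h ▸ infDist_le_hausdorffDist_of_mem hx
    (hausdorffEDist_ne_top_of_nonempty_of_bounded ⟨x, hx⟩ hBne hA.isBounded hB.isBounded)⟩

section Dilation

variable {E : Type*} [NormedAddCommGroup E] [NormedSpace ℝ E] {A B : Set E} {M c R : ℝ}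

theorem hausdorffDist_le_of_subset_smul (hc : 1 ≤ c) (hR : 0 ≤ R) (hA : A ⊆ closedBall 0 R)
    (hB : B ⊆ closedBall 0 R) (hAB : A ⊆ c • B) (hBA : B ⊆ c • A) :
    hausdorffDist A B ≤ (c - 1) * R := by
  have key : ∀ C D : Set E, D ⊆ closedBall 0 R → C ⊆ c • D →
      ∀ x ∈ C, ∃ y ∈ D, dist x y ≤ (c - 1) * R := by
    intro C D hD hCD x hx
    obtain ⟨y, hy, rfl⟩ := hCD hx
    refine ⟨y, hy, ?_⟩
    have h1 : c • y - y = (c - 1) • y := by rw [sub_smul, one_smul]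
    rw [dist_eq_norm]
    simp only [h1, norm_smul, Real.norm_of_nonneg (sub_nonneg.2 hc)]
    exact mul_le_mul_of_nonneg_left (mem_closedBall_zero_iff.1 (hD hy)) (sub_nonneg.2 hc)
  exact hausdorffDist_le_of_mem_dist (mul_nonneg (sub_nonneg.2 hc) hR) (key A B hB hAB)
    (key B A hA hBA)

theorem IsOriginBody.subset_smul_of_hausdorffDist (hA : IsOriginBody A) (hB : IsOriginBody B)
    (hM : Pinched M B) : A ⊆ (1 + hausdorffDist A B * M) • B := by
  intro x hx
  obtain ⟨y, hy, hxy⟩ := exists_dist_le_hausdorffDist hA.isCompact hB.isCompact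
    ⟨0, hB.zero_mem⟩ hx
  have hd : 0 ≤ hausdorffDist A B * M := mul_nonneg hausdorffDist_nonneg hM.pos.le
  rw [hB.convex.add_smul zero_le_one hd, one_smul]
  refine ⟨y, hy, x - y, smul_set_mono hM.ball_subset ?_, by simp⟩
  rw [smul_closedBall _ _ (inv_pos.2 hM.pos).le, smul_zero, Real.norm_of_nonneg hd,
    mul_assoc, mul_inv_cancel₀ hM.pos.ne', mul_one, mem_closedBall_zero_iff]
  rwa [dist_eq_norm] at hxy

/-- Separate a missing point from A by f, and let w maximize f on B. Since B contains the ball of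
radius M⁻¹, ‖f‖ ≤ M f(w), so a point of A near w has f at least (1 - dM) f(w), with d the Hausdorff
distance. This contradicts the separation. -/
theorem IsOriginBody.smul_subset_of_hausdorffDist (hA : IsOriginBody A) (hB : IsOriginBody B)
    (hM : Pinched M B) (hd : hausdorffDist A B * M ≤ 1) :
    (1 - hausdorffDist A B * M) • B ⊆ A := by
  rintro _ ⟨z, hz, rfl⟩
  by_contra hzA
  obtain ⟨f, u, hfA, hfz⟩ :=
    geometric_hahn_banach_closed_point hA.convex hA.isCompact.isClosed hzA
  obtain ⟨w, hw, hmax⟩ := hB.isCompact.exists_isMaxOn ⟨0, hB.zero_mem⟩ f.continuous.continuousOn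
  have hmax : ∀ v ∈ B, f v ≤ f w := hmax
  have hw0 : 0 ≤ f w := by simpa using hmax 0 hB.zero_mem
  have hnorm : ‖f‖ ≤ M * f w := by
    refine f.opNorm_le_bound (mul_nonneg hM.pos.le hw0) ?_
    have hle : ∀ x : E, f x ≤ M * f w * ‖x‖ := by
      intro x
      rcases eq_or_ne x 0 with rfl | hx
      · simp
      have hx0 : 0 < ‖x‖ := norm_pos_iff.2 hx
      have h1 := hmax ((M⁻¹ * ‖x‖⁻¹) • x) (hM.ball_subset (by
        rw [mem_closedBall_zero_iff, norm_smul, Real.norm_of_nonneg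
          (mul_nonneg (inv_pos.2 hM.pos).le (inv_pos.2 hx0).le), mul_assoc,
          inv_mul_cancel₀ hx0.ne', mul_one]))
      rw [map_smul, smul_eq_mul, ← mul_inv, inv_mul_le_iff₀ (mul_pos hM.pos hx0)] at h1
      linarith
    intro x
    rw [Real.norm_eq_abs, abs_le]
    refine ⟨?_, hle x⟩
    have := hle (-x)
    rw [map_neg, norm_neg] at this
    linarith
  obtain ⟨y, hy, hwy⟩ := exists_dist_le_hausdorffDist hB.isCompact hA.isCompact
    ⟨0, hA.zero_mem⟩ hw
  rw [hausdorffDist_comm, dist_eq_norm] at hwy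
  have h1 : f w - f y ≤ ‖f‖ * ‖w - y‖ := by
    rw [← map_sub]
    exact (le_abs_self _).trans (f.le_opNorm _)
  have h2 : ‖f‖ * ‖w - y‖ ≤ M * f w * hausdorffDist A B := by
    gcongr
    exact mul_nonneg hM.pos.le hw0
  have h3 := hfA y hy
  simp only [map_smul, smul_eq_mul] at hfz
  have h4 := mul_le_mul_of_nonneg_left (hmax z hz) (sub_nonneg.2 hd)
  nlinarith

end Dilation

/-! ### Powers of bodies and joint continuity -/

section PowerSet

variable {n : ℕ} {K K₁ K₂ : Set (Euc n)} {p q M : ℝ}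

theorem powerSet_zero (K : Set (Euc n)) : powerSet 0 K = closedBall 0 1 := if_pos rfl

theorem IsOriginBody.powerSet_eq_rangePow (hp : 0 < p) :
    ∃ S : Set ℝ, IsExponentRange S ∧ p ∈ S ∧
      ∀ K : Set (Euc n), IsOriginBody K → powerSet p K = _root_.rangePow S p K := by
  rcases le_total p 1 with h | h
  · exact ⟨Ioc 0 1, isExponentRange_Ioc, ⟨hp, h⟩, fun K hK => hK.powerSet_of_le_one hp h⟩
  · exact ⟨Ici 1, isExponentRange_Ici, h, fun K hK => hK.powerSet_of_one_le h⟩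

theorem isOriginBody_closedBall {E : Type*} [NormedAddCommGroup E] [NormedSpace ℝ E]
    [FiniteDimensional ℝ E] {r : ℝ} (hr : 0 < r) : IsOriginBody (closedBall (0 : E) r) :=
  ⟨convex_closedBall 0 r, isCompact_closedBall 0 r,
    mem_interior_iff_mem_nhds.2 (closedBall_mem_nhds 0 hr)⟩

theorem IsOriginBody.powerSet (hK : IsOriginBody K) (hp : 0 ≤ p) : IsOriginBody (powerSet p K) := by
  rcases hp.eq_or_lt with rfl | hp
  · rw [powerSet_zero]
    exact isOriginBody_closedBall one_pos
  · obtain ⟨S, hS, hpS, h⟩ := IsOriginBody.powerSet_eq_rangePow (n := n) hp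
    rw [h K hK]
    exact hK.rangePow hS hpS

theorem Pinched.powerSet (hM : Pinched M K) (hK : IsOriginBody K) (hp : 0 ≤ p) :
    Pinched (M ^ p) (powerSet p K) := by
  rcases hp.eq_or_lt with rfl | hp
  · rw [powerSet_zero, Real.rpow_zero]
    exact ⟨le_rfl, by rw [inv_one], subset_rfl⟩
  · obtain ⟨S, hS, hpS, h⟩ := IsOriginBody.powerSet_eq_rangePow (n := n) hp
    rw [h K hK]
    exact hM.rangePow hS hpS

theorem IsOriginBody.powerSet_mono (h₁ : IsOriginBody K₁) (h₂ : IsOriginBody K₂) (hp : 0 ≤ p)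
    (h : K₁ ⊆ K₂) : _root_.powerSet p K₁ ⊆ _root_.powerSet p K₂ := by
  rcases hp.eq_or_lt with rfl | hp
  · rw [powerSet_zero, powerSet_zero]
  · obtain ⟨S, hS, hpS, hpow⟩ := IsOriginBody.powerSet_eq_rangePow (n := n) hp
    rw [hpow _ h₁, hpow _ h₂]
    exact rangePow_mono h

theorem IsOriginBody.smul (hK : IsOriginBody K) {t : ℝ} (ht : 0 < t) : IsOriginBody (t • K) :=
  ⟨hK.convex.smul t, hK.isCompact.smul t, by
    rw [interior_smul₀ ht.ne']
    exact ⟨0, hK.zero_mem_interior, smul_zero t⟩⟩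

theorem IsOriginBody.powerSet_smul (hK : IsOriginBody K) (hp : 0 ≤ p) {t : ℝ} (ht : 0 < t) :
    _root_.powerSet p (t • K) = t ^ p • _root_.powerSet p K := by
  rcases hp.eq_or_lt with rfl | hp
  · rw [powerSet_zero, powerSet_zero, Real.rpow_zero, one_smul]
  · obtain ⟨S, hS, hpS, hpow⟩ := IsOriginBody.powerSet_eq_rangePow (n := n) hp
    rw [hpow _ (hK.smul ht), hpow _ hK, rangePow_smul ht]

theorem IsOriginBody.powerSet_powerSet (hK : IsOriginBody K) (hp : 0 ≤ p) (hq : 0 ≤ q)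
    (h : (p ≤ 1 ∧ q ≤ 1) ∨ (1 ≤ p ∧ 1 ≤ q)) :
    _root_.powerSet q (_root_.powerSet p K) = _root_.powerSet (p * q) K := by
  rcases hq.eq_or_lt with rfl | hq
  · rw [mul_zero, powerSet_zero, powerSet_zero]
  rcases hp.eq_or_lt with rfl | hp
  · rw [zero_mul, powerSet_zero]
    -- The unit ball is pinched with constant 1, and 1 ^ q = 1, so every power fixes it.
    have h1 : Pinched 1 (closedBall (0 : Euc n) 1) := ⟨le_rfl, by rw [inv_one], subset_rfl⟩
    have h2 := h1.powerSet (isOriginBody_closedBall one_pos) hq.le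
    rw [Real.one_rpow] at h2
    exact h2.subset_ball.antisymm (by simpa using h2.ball_subset)
  rcases h with ⟨hp1, hq1⟩ | ⟨hp1, hq1⟩
  · rw [(hK.powerSet hp.le).powerSet_of_le_one hq hq1, hK.powerSet_of_le_one hp hp1,
      hK.powerSet_of_le_one (mul_pos hp hq) (mul_le_one₀ hp1 hq.le hq1),
      hK.rangePow_rangePow isExponentRange_Ioc ⟨hp, hp1⟩ ⟨hq, hq1⟩]
  · rw [(hK.powerSet hp.le).powerSet_of_one_le hq1, hK.powerSet_of_one_le hp1,
      hK.powerSet_of_one_le (one_le_mul_of_one_le_of_one_le hp1 hq1),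
      hK.rangePow_rangePow isExponentRange_Ici hp1 hq1]

/-- By the semigroup law one of the two powers is a further power of the other, with exponent q / p
or p / q; comparing it with exponent 1 costs (M ^ p) ^ |q / p - 1| = M ^ |q - p| in the first case,
and symmetrically in the second. -/
theorem IsOriginBody.rangePow_subset_smul_rangePow {S : Set ℝ} (hK : IsOriginBody K)
    (hM : Pinched M K) (hS : IsExponentRange S) (hp : p ∈ S) (hq : q ∈ S) :
    _root_.rangePow S q K ⊆ M ^ |q - p| • _root_.rangePow S p K := by
  have hp0 := hS.pos hp
  have hq0 := hS.pos hq
  rcases hS.div_mem_or hq hp with h | h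
  · have hbody := hK.rangePow hS hp
    have := (hM.rangePow hS hp).rangePow_subset_smul (p := q / p) hS hbody.convex
      hbody.isCompact.isClosed
    rw [hK.rangePow_rangePow hS hp h, mul_div_cancel₀ _ hp0.ne', ← Real.rpow_mul hM.pos.le,
      ← abs_of_pos hp0, ← abs_mul, abs_of_pos hp0, mul_sub, mul_one,
      mul_div_cancel₀ _ hp0.ne'] at this
    exact this
  · have hbody := hK.rangePow hS hq
    have := (hM.rangePow hS hq).subset_smul_rangePow hS hbody.convex h
    rw [hK.rangePow_rangePow hS hq h, mul_div_cancel₀ _ hq0.ne', ← Real.rpow_mul hM.pos.le,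
      ← abs_of_pos hq0, ← abs_mul, abs_of_pos hq0, mul_sub, mul_one,
      mul_div_cancel₀ _ hq0.ne', abs_sub_comm] at this
    exact this

/-- The power depends on the exponent in a Lipschitz way, up to dilation. -/
theorem IsOriginBody.powerSet_subset_smul_powerSet (hK : IsOriginBody K) (hM : Pinched M K)
    (hp : 0 ≤ p) (hq : 0 ≤ q) :
    _root_.powerSet q K ⊆ M ^ |q - p| • _root_.powerSet p K := by
  have hM0 := hM.pos
  rcases hp.eq_or_lt with rfl | hp
  · rw [powerSet_zero, sub_zero, abs_of_nonneg hq, _root_.smul_closedBall _ _ zero_le_one, smul_zero,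
      Real.norm_of_nonneg (by positivity), mul_one]
    exact (hM.powerSet hK hq).subset_ball
  rcases hq.eq_or_lt with rfl | hq
  · rw [powerSet_zero, zero_sub, abs_neg, abs_of_nonneg hp.le]
    have h1 := smul_set_mono (a := M ^ p) (hM.powerSet hK hp.le).ball_subset
    rwa [_root_.smul_closedBall _ _ (by positivity), smul_zero, Real.norm_of_nonneg (by positivity),
      mul_inv_cancel₀ (by positivity)] at h1
  -- When 1 separates p and q there is no common range, and the comparison passes through K itself.
  have through_one : |q - p| = |q - 1| + |1 - p| →
      _root_.powerSet q K ⊆ M ^ |q - p| • _root_.powerSet p K := by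
    intro h
    obtain ⟨S, hS, hqS, hq'⟩ := IsOriginBody.powerSet_eq_rangePow (n := n) hq
    obtain ⟨T, hT, hpT, hp'⟩ := IsOriginBody.powerSet_eq_rangePow (n := n) hp
    have h1 := hK.rangePow_subset_smul_rangePow hM hS hS.one_mem hqS
    have h2 := hK.rangePow_subset_smul_rangePow hM hT hpT hT.one_mem
    rw [rangePow_one hS hK] at h1
    rw [rangePow_one hT hK] at h2
    rw [hq' K hK, hp' K hK, h, Real.rpow_add hM0, mul_smul]
    exact h1.trans (smul_set_mono h2)
  rcases le_total p 1 with hp1 | hp1 <;> rcases le_total q 1 with hq1 | hq1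
  · rw [hK.powerSet_of_le_one hp hp1, hK.powerSet_of_le_one hq hq1]
    exact hK.rangePow_subset_smul_rangePow hM isExponentRange_Ioc ⟨hp, hp1⟩ ⟨hq, hq1⟩
  · apply through_one
    rw [abs_of_nonneg (by linarith), abs_of_nonneg (by linarith), abs_of_nonneg (by linarith)]
    ring
  · apply through_one
    rw [abs_of_nonpos (by linarith), abs_of_nonpos (by linarith), abs_of_nonpos (by linarith)]
    ring
  · rw [hK.powerSet_of_one_le hp1, hK.powerSet_of_one_le hq1]
    exact hK.rangePow_subset_smul_rangePow hM isExponentRange_Ici hp1 hq1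

theorem OriginBody.isOriginBody (K : OriginBody n) : IsOriginBody K.toSet :=
  ⟨K.1.convex, K.1.isCompact, K.2⟩

theorem OriginBody.ext {K L : OriginBody n} (h : K.toSet = L.toSet) : K = L :=
  Subtype.ext (ConvexBody.ext h)

theorem OriginBody.dist_eq (K L : OriginBody n) : dist K L = hausdorffDist K.toSet L.toSet := rfl

/-- The power of a body, as a body. -/
noncomputable def OriginBody.pow (p : ℝ≥0) (K : OriginBody n) : OriginBody n :=
  have h := K.isOriginBody.powerSet p.coe_nonneg
  ⟨⟨_root_.powerSet p K.toSet, h.convex, h.isCompact, ⟨0, h.zero_mem⟩⟩, h.zero_mem_interior⟩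

theorem OriginBody.toSet_pow (p : ℝ≥0) (K : OriginBody n) :
    (K.pow p).toSet = _root_.powerSet p K.toSet := rfl

/-- K and L agree up to the dilation c = (1 - dist K L * M)⁻¹ ≤ 2, so both are pinched by 2 * M.
Homogeneity turns c into c ^ q, and changing the exponent costs (2 * M) ^ |p - q|. -/
theorem OriginBody.dist_pow_le {K L : OriginBody n} (hM : Pinched M L.toSet)
    (hd : dist K L * M ≤ 1 / 2) (p q : ℝ≥0) :
    dist (K.pow p) (L.pow q) ≤
      ((2 * M) ^ |(p : ℝ) - q| * (1 - dist K L * M)⁻¹ ^ (q : ℝ) - 1) * (2 * M) ^ max (p : ℝ) q := by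
  have hK := K.isOriginBody
  have hL := L.isOriginBody
  have hM0 := hM.pos
  have hd0 : 0 ≤ dist K L * M := mul_nonneg dist_nonneg hM0.le
  rw [OriginBody.dist_eq, toSet_pow, toSet_pow]
  rw [OriginBody.dist_eq] at hd hd0 ⊢
  have h1 := hK.subset_smul_of_hausdorffDist hL hM
  have h2 := hK.smul_subset_of_hausdorffDist hL hM (by linarith)
  set d := hausdorffDist K.toSet L.toSet * M
  set c := (1 - d)⁻¹ with hc
  have hpos : 0 < 1 - d := by linarith
  have hc1 : 1 ≤ c := (one_le_inv₀ hpos).2 (by linarith)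
  have hc2 : c ≤ 2 := by
    rw [hc, inv_le_comm₀ hpos two_pos]
    linarith
  have hc0 : 0 < c := one_pos.trans_le hc1
  have hKL : K.toSet ⊆ c • L.toSet := by
    refine h1.trans (hL.starConvex.smul_subset_smul (by linarith) ?_)
    rw [hc, le_inv_comm₀ (by linarith) hpos]
    rw [le_inv_comm₀ hpos (by linarith), ← one_div, le_div_iff₀ hpos]
    nlinarith
  have hLK : L.toSet ⊆ c • K.toSet := by
    rw [hc]
    exact (smul_set_subset_iff₀ hpos.ne').1 h2
  have hL2 : Pinched (2 * M) L.toSet := hM.mono (by linarith)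
  have hK2 : Pinched (2 * M) K.toSet := by
    refine ⟨by linarith [hM.one_le], ?_, ?_⟩
    · have h3 := hM.ball_subset.trans (hLK.trans (hK.starConvex.smul_subset_smul hc0.le hc2))
      have h4 : (2 : ℝ)⁻¹ • closedBall (0 : Euc n) M⁻¹ ⊆ K.toSet :=
        (smul_set_subset_iff₀ (by norm_num)).2 (by rwa [inv_inv])
      rwa [_root_.smul_closedBall _ _ (by positivity), smul_zero,
        Real.norm_of_nonneg (by norm_num), ← mul_inv] at h4
    · refine (hKL.trans (hL.starConvex.smul_subset_smul hc0.le hc2)).trans ?_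
      refine (smul_set_mono hM.subset_ball).trans ?_
      rw [smul_closedBall _ _ hM0.le, smul_zero, Real.norm_of_nonneg zero_le_two]
  have hM2 : 1 ≤ 2 * M := by linarith [hM.one_le]
  have hA : _root_.powerSet p K.toSet ⊆
      ((2 * M) ^ |(p : ℝ) - q| * c ^ (q : ℝ)) • _root_.powerSet q L.toSet := by
    rw [mul_smul, ← hL.powerSet_smul q.coe_nonneg hc0]
    exact (hK.powerSet_subset_smul_powerSet hK2 q.coe_nonneg p.coe_nonneg).trans
      (smul_set_mono (hK.powerSet_mono (hL.smul hc0) q.coe_nonneg hKL))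
  have hB : _root_.powerSet q L.toSet ⊆
      ((2 * M) ^ |(p : ℝ) - q| * c ^ (q : ℝ)) • _root_.powerSet p K.toSet := by
    rw [mul_comm, mul_smul, abs_sub_comm]
    refine Subset.trans ?_ (smul_set_mono (hK.powerSet_subset_smul_powerSet hK2 p.coe_nonneg q.coe_nonneg))
    rw [← hK.powerSet_smul q.coe_nonneg hc0]
    exact hL.powerSet_mono (hK.smul hc0) q.coe_nonneg hLK
  refine hausdorffDist_le_of_subset_smul ?_ (by positivity) ?_ ?_ hA hB
  · exact one_le_mul_of_one_le_of_one_le (Real.one_le_rpow hM2 (abs_nonneg _))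
      (Real.one_le_rpow hc1 q.coe_nonneg)
  · exact (hK2.powerSet hK p.coe_nonneg).subset_ball.trans (closedBall_subset_closedBall
      (Real.rpow_le_rpow_of_exponent_le hM2 (le_max_left _ _)))
  · exact (hL2.powerSet hL q.coe_nonneg).subset_ball.trans (closedBall_subset_closedBall
      (Real.rpow_le_rpow_of_exponent_le hM2 (le_max_right _ _)))

theorem OriginBody.continuous_pow :
    Continuous fun z : OriginBody n × ℝ≥0 => z.1.pow z.2 := by
  rw [continuous_iff_continuousAt]
  rintro ⟨L, q⟩
  obtain ⟨M, hM⟩ := L.isOriginBody.exists_pinched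
  have hM0 := hM.pos
  have hdist : Continuous fun z : OriginBody n × ℝ≥0 => dist z.1 L * M := by fun_prop
  rw [ContinuousAt, tendsto_iff_dist_tendsto_zero]
  refine squeeze_zero' (g := fun z : OriginBody n × ℝ≥0 =>
    ((2 * M) ^ |(z.2 : ℝ) - q| * (1 - dist z.1 L * M)⁻¹ ^ (q : ℝ) - 1) *
      (2 * M) ^ max (z.2 : ℝ) q) (Filter.Eventually.of_forall fun _ => dist_nonneg) ?_ ?_
  · have : ∀ᶠ z : OriginBody n × ℝ≥0 in nhds (L, q), dist z.1 L * M < 1 / 2 :=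
      hdist.continuousAt.eventually_lt continuousAt_const (by simp)
    filter_upwards [this] with z hz
    exact OriginBody.dist_pow_le hM hz.le z.2 q
  · have h1 : ContinuousAt (fun z : OriginBody n × ℝ≥0 =>
        ((2 * M) ^ |(z.2 : ℝ) - q| * (1 - dist z.1 L * M)⁻¹ ^ (q : ℝ) - 1) *
          (2 * M) ^ max (z.2 : ℝ) q) (L, q) := by
      refine ContinuousAt.mul (ContinuousAt.sub (ContinuousAt.mul ?_ ?_) continuousAt_const) ?_
      · exact continuousAt_const.rpow (by fun_prop) (Or.inl (by positivity))
      · refine ContinuousAt.rpow (ContinuousAt.inv₀ ?_ (by simp)) continuousAt_const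
          (Or.inl (by simp))
        fun_prop
      · exact continuousAt_const.rpow (by fun_prop) (Or.inl (by positivity))
    simpa [ContinuousAt] using h1

end PowerSet

/-! ### Convexity of radial powers of nearly round bodies -/

/-- First and second order conditions at a local maximum of the logarithm of
`Q ^ (β / 2) * L` with `Q` quadratic and `L` affine. -/
theorem IsLocalMax.log_quadratic_add_log_affine {a b c l m β : ℝ} (ha : 0 < a) (hl : 0 < l)
    (h : IsLocalMax (fun τ : ℝ => β / 2 * Real.log (a + 2 * b * τ + c * τ ^ 2) +
      Real.log (l + m * τ)) 0) :
    β * b / a + m / l = 0 ∧ β * (c / a - 2 * b ^ 2 / a ^ 2) - m ^ 2 / l ^ 2 ≤ 0 := by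
  set G := fun τ : ℝ => β / 2 * Real.log (a + 2 * b * τ + c * τ ^ 2) + Real.log (l + m * τ)
    with hG
  set Q : ℝ → ℝ := fun τ => a + 2 * b * τ + c * τ ^ 2 with hQ
  set L : ℝ → ℝ := fun τ => l + m * τ with hL
  have hQ' : ∀ τ, HasDerivAt Q (2 * b + 2 * c * τ) τ := by
    intro τ
    exact (((hasDerivAt_const τ a).add ((hasDerivAt_id τ).const_mul (2 * b))).add
      ((hasDerivAt_pow 2 τ).const_mul c)).congr_deriv (by norm_num; ring)
  have hL' : ∀ τ, HasDerivAt L m τ := by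
    intro τ
    exact ((hasDerivAt_const τ l).add ((hasDerivAt_id τ).const_mul m)).congr_deriv (by simp)
  have hQ0 : Q 0 = a := by simp [hQ]
  have hL0 : L 0 = l := by simp [hL]
  have hQpos : ∀ᶠ τ in nhds 0, 0 < Q τ :=
    (hQ' 0).continuousAt.eventually_const_lt (by rwa [hQ0])
  have hLpos : ∀ᶠ τ in nhds 0, 0 < L τ :=
    (hL' 0).continuousAt.eventually_const_lt (by rwa [hL0])
  set D : ℝ → ℝ := fun τ => β / 2 * ((2 * b + 2 * c * τ) / Q τ) + m / L τ with hD
  have hGD : ∀ᶠ τ in nhds 0, HasDerivAt G (D τ) τ := by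
    filter_upwards [hQpos, hLpos] with τ h1 h2
    exact (((hQ' τ).log h1.ne').const_mul _).add ((hL' τ).log h2.ne')
  have hderiv : deriv G =ᶠ[nhds 0] D := hGD.mono fun τ hτ => hτ.deriv
  have hD0 : D 0 = β * b / a + m / l := by
    simp only [hD, hQ0, hL0]
    ring
  have hDD : HasDerivAt D (β * (c / a - 2 * b ^ 2 / a ^ 2) - m ^ 2 / l ^ 2) 0 := by
    have h1 : HasDerivAt (fun τ : ℝ => 2 * b + 2 * c * τ) (2 * c) 0 := by
      simpa using ((hasDerivAt_id (0 : ℝ)).const_mul (2 * c)).const_add (2 * b)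
    have h2 := ((h1.div (hQ' 0) (by rw [hQ0]; exact ha.ne')).const_mul (β / 2)).add
      ((hasDerivAt_const (0 : ℝ) m).div (hL' 0) (by rw [hL0]; exact hl.ne'))
    refine h2.congr_deriv ?_
    rw [hQ0, hL0]
    field_simp
    ring
  have hfirst : deriv G 0 = 0 := h.deriv_eq_zero
  have hsecond : deriv (deriv G) 0 = β * (c / a - 2 * b ^ 2 / a ^ 2) - m ^ 2 / l ^ 2 := by
    rw [hderiv.deriv_eq, hDD.deriv]
  refine ⟨by rw [← hD0, ← hderiv.self_of_nhds, hfirst], ?_⟩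
  by_contra! hpos
  rw [← hsecond] at hpos
  -- A positive second derivative would make 0 a local minimum too, so G would be locally constant
  -- and its second derivative zero.
  have hmin := isLocalMin_of_deriv_deriv_pos hpos hfirst hGD.self_of_nhds.continuousAt
  have hconst : G =ᶠ[nhds 0] fun _ => G 0 := by
    filter_upwards [h, hmin] with τ h1 h2
    exact le_antisymm h1 h2
  have h3 := hconst.deriv.deriv_eq
  simp only [deriv_const'] at h3
  exact hpos.ne' h3

section

variable {E : Type*} [NormedAddCommGroup E] [InnerProductSpace ℝ E]

/-- The first order condition determines ⟨v, d⟩ from ⟨z, d⟩. Cauchy–Schwarz for the components of v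
and d orthogonal to z, with the angle between v and z below π/4, then forces d to be so transversal
to z that the logarithm has positive second derivative. -/
theorem not_isLocalMax_norm_rpow_mul_inner {β : ℝ} (hβ : 0 < β) {z d v : E} (hd : d ≠ 0)
    (hz : 0 < inner ℝ v z) (hv : ‖v‖ ^ 2 * ‖z‖ ^ 2 < 2 * inner ℝ v z ^ 2) :
    ¬ IsLocalMax (fun τ : ℝ => ‖z + τ • d‖ ^ β * inner ℝ v (z + τ • d)) 0 := by
  intro h
  have hz0 : z ≠ 0 := by
    rintro rfl
    simp at hz
  set a := ‖z‖ ^ 2 with ha_def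
  have ha : 0 < a := by
    have := norm_pos_iff.2 hz0
    positivity
  set b := inner ℝ z d with hb
  set c := ‖d‖ ^ 2 with hc_def
  have hc : 0 < c := by
    have := norm_pos_iff.2 hd
    positivity
  set l := inner ℝ v z with hl
  set m := inner ℝ v d with hm
  have hnorm : ∀ τ : ℝ, ‖z + τ • d‖ ^ 2 = a + 2 * b * τ + c * τ ^ 2 := by
    intro τ
    rw [norm_add_sq_real, norm_smul, inner_smul_right, mul_pow, Real.norm_eq_abs, sq_abs]
    ring
  have hinner : ∀ τ : ℝ, inner ℝ v (z + τ • d) = l + m * τ := by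
    intro τ
    rw [inner_add_right, inner_smul_right]
    ring
  have hlog : IsLocalMax (fun τ : ℝ => β / 2 * Real.log (a + 2 * b * τ + c * τ ^ 2) +
      Real.log (l + m * τ)) 0 := by
    have hc1 : ContinuousAt (fun τ : ℝ => a + 2 * b * τ + c * τ ^ 2) 0 := by fun_prop
    have hc2 : ContinuousAt (fun τ : ℝ => l + m * τ) 0 := by fun_prop
    have key : ∀ τ : ℝ, 0 < a + 2 * b * τ + c * τ ^ 2 → 0 < l + m * τ →
        0 < ‖z + τ • d‖ ^ β * inner ℝ v (z + τ • d) ∧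
        β / 2 * Real.log (a + 2 * b * τ + c * τ ^ 2) + Real.log (l + m * τ) =
          Real.log (‖z + τ • d‖ ^ β * inner ℝ v (z + τ • d)) := by
      intro τ h1 h2
      have hpos : 0 < ‖z + τ • d‖ := by
        rw [← hnorm] at h1
        exact (norm_nonneg _).lt_of_ne fun h0 => by simp [← h0] at h1
      rw [hinner]
      refine ⟨by positivity, ?_⟩
      rw [Real.log_mul (by positivity) h2.ne', Real.log_rpow hpos, ← hnorm, Real.log_pow]
      push_cast
      ring
    filter_upwards [h, hc1.eventually_const_lt (by simpa using ha),
      hc2.eventually_const_lt (by simpa using hz)] with τ hτ h1 h2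
    obtain ⟨h3, h4⟩ := key τ h1 h2
    obtain ⟨-, h6⟩ := key 0 (by simpa using ha) (by simpa using hz)
    rw [h4, h6]
    exact Real.log_le_log h3 hτ
  obtain ⟨h1, h2⟩ := hlog.log_quadratic_add_log_affine ha hz
  have hm' : m = -(β * b * l / a) := by
    field_simp at h1 ⊢
    linarith
  have hcs : (m - b * l / a) ^ 2 ≤ (c - b ^ 2 / a) * (‖v‖ ^ 2 - l ^ 2 / a) := by
    have h3 := real_inner_mul_inner_self_le (v - (l / a) • z) (d - (b / a) • z)
    have e1 : inner ℝ (v - (l / a) • z) (d - (b / a) • z) = m - b * l / a := by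
      simp only [inner_sub_left, inner_sub_right, inner_smul_left, inner_smul_right,
        real_inner_self_eq_norm_sq, RCLike.conj_to_real]
      rw [← hm, ← hl, ← hb, ← ha_def]
      field_simp
      ring
    have e2 : inner ℝ (v - (l / a) • z) (v - (l / a) • z) = ‖v‖ ^ 2 - l ^ 2 / a := by
      simp only [inner_sub_left, inner_sub_right, inner_smul_left, inner_smul_right,
        real_inner_self_eq_norm_sq, RCLike.conj_to_real]
      rw [real_inner_comm v z, ← hl, ← ha_def]
      field_simp
      ring
    have e3 : inner ℝ (d - (b / a) • z) (d - (b / a) • z) = c - b ^ 2 / a := by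
      simp only [inner_sub_left, inner_sub_right, inner_smul_left, inner_smul_right,
        real_inner_self_eq_norm_sq, RCLike.conj_to_real]
      rw [real_inner_comm z d, ← hb, ← ha_def, ← hc_def]
      field_simp
      ring
    rw [e1, e2, e3] at h3
    nlinarith
  set W := c - b ^ 2 / a with hW
  have hV : ‖v‖ ^ 2 - l ^ 2 / a < l ^ 2 / a := by
    rw [sub_lt_iff_lt_add, ← add_div, lt_div_iff₀ ha]
    linarith
  have hla : 0 < l ^ 2 / a := by positivity
  have hcs' : (1 + β) ^ 2 * b ^ 2 / a * (l ^ 2 / a) ≤ W * (‖v‖ ^ 2 - l ^ 2 / a) := by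
    refine le_trans (le_of_eq ?_) hcs
    rw [hm']
    field_simp
    ring
  have hb0 : 0 ≤ b ^ 2 / a := by positivity
  have hW0 : 0 ≤ W := by
    have := real_inner_mul_inner_self_le z d
    rw [real_inner_self_eq_norm_sq, real_inner_self_eq_norm_sq] at this
    rw [hW, sub_nonneg, div_le_iff₀ ha]
    nlinarith
  have hWpos : 0 < W := by
    refine hW0.lt_of_ne fun h0 => ?_
    rw [← h0, zero_mul] at hcs'
    have h3 : 0 < (1 + β) ^ 2 * b ^ 2 / a * (l ^ 2 / a) := by
      have : 0 < b ^ 2 / a := by linarith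
      have : (1 + β) ^ 2 * b ^ 2 / a = (1 + β) ^ 2 * (b ^ 2 / a) := by ring
      rw [this]
      positivity
    linarith
  have hlt : (1 + β) ^ 2 * (b ^ 2 / a) < W := by
    have h3 : (1 + β) ^ 2 * b ^ 2 / a * (l ^ 2 / a) < W * (l ^ 2 / a) :=
      hcs'.trans_lt (mul_lt_mul_of_pos_left hV hWpos)
    rw [mul_div_assoc] at h3
    exact lt_of_mul_lt_mul_right h3 hla.le
  have hG : β * (c / a - 2 * b ^ 2 / a ^ 2) - m ^ 2 / l ^ 2 =
      β / a * (W - (1 + β) * (b ^ 2 / a)) := by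
    rw [hm', hW]
    field_simp
    ring
  rw [hG] at h2
  have h4 : 0 < W - (1 + β) * (b ^ 2 / a) := by nlinarith
  exact absurd h2 (not_le.2 (by positivity))

/-- A ball cut by a radial power of a half-space is convex as long as the position and normal
vectors at the cut make an angle of at most `π / 4`. -/
theorem convex_norm_rpow_mul_inner_le {β ρ : ℝ} (hβ : 0 < β) {v : E}
    (hv : ‖v‖ ^ 2 * (ρ * ρ ^ β) ^ 2 ≤ 2) :
    Convex ℝ {x : E | ‖x‖ ≤ ρ ∧ ‖x‖ ^ β * inner ℝ v x ≤ 1} := by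
  rw [convex_iff_segment_subset]
  rintro x ⟨hx, hx1⟩ y ⟨hy, hy1⟩
  have hball : ∀ z ∈ segment ℝ x y, ‖z‖ ≤ ρ := by
    intro z hz
    simpa using (convex_closedBall (0 : E) ρ).segment_subset (by simpa using hx)
      (by simpa using hy) hz
  rw [segment_eq_image'] at hball ⊢
  rintro _ ⟨τ, hτ, rfl⟩
  refine ⟨hball _ ⟨τ, hτ, rfl⟩, ?_⟩
  by_contra! hgt
  set d := y - x with hd
  set f : ℝ → ℝ := fun σ => ‖x + σ • d‖ ^ β * inner ℝ v (x + σ • d) with hf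
  have hcont : Continuous f := by
    have h1 : Continuous fun σ : ℝ => x + σ • d := by fun_prop
    exact (h1.norm.rpow_const fun _ => Or.inr hβ.le).mul (continuous_const.inner h1)
  -- A violation inside the segment gives an interior maximum of f with value above 1. There the
  -- norm bound gives the angle condition, which excludes a local maximum.
  obtain ⟨σ, hσ, hmax⟩ := isCompact_Icc.exists_isMaxOn ⟨τ, hτ⟩ hcont.continuousOn
  have hσ1 : 1 < f σ := hgt.trans_le (hmax hτ)
  have hf0 : f 0 ≤ 1 := by simpa [hf] using hx1
  have hf1 : f 1 ≤ 1 := by simpa [hf, hd] using hy1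
  have hne0 : σ ≠ 0 := by
    rintro rfl
    linarith
  have hne1 : σ ≠ 1 := by
    rintro rfl
    linarith
  have hσI : σ ∈ Ioo (0 : ℝ) 1 := ⟨hσ.1.lt_of_ne hne0.symm, hσ.2.lt_of_ne hne1⟩
  have hlocal : IsLocalMax f σ := hmax.isLocalMax (Icc_mem_nhds hσI.1 hσI.2)
  set z := x + σ • d with hz
  have hzρ : ‖z‖ ≤ ρ := hball z ⟨σ, hσ, rfl⟩
  have hσ1' : 1 < ‖z‖ ^ β * inner ℝ v z := hσ1
  have hinner : 0 < inner ℝ v z := by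
    by_contra! h
    have := mul_nonpos_of_nonneg_of_nonpos (Real.rpow_nonneg (norm_nonneg z) β) h
    linarith
  refine not_isLocalMax_norm_rpow_mul_inner hβ (z := z) (d := d) (v := v) ?_ hinner ?_ ?_
  · intro h0
    have : f σ = f 0 := by simp [hf, h0]
    linarith
  · have hzpos : 0 < ‖z‖ ^ β := pos_of_mul_pos_left (by linarith) hinner.le
    have h1 : ‖v‖ ^ 2 * (‖z‖ * ‖z‖ ^ β) ^ 2 ≤ 2 := by
      have hρ : 0 ≤ ρ := (norm_nonneg z).trans hzρ
      refine le_trans ?_ hv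
      gcongr
    have h2 : 2 < 2 * (‖z‖ ^ β * inner ℝ v z) ^ 2 := by nlinarith
    have h3 : (‖v‖ ^ 2 * ‖z‖ ^ 2) * (‖z‖ ^ β) ^ 2 < (2 * inner ℝ v z ^ 2) * (‖z‖ ^ β) ^ 2 := by
      nlinarith
    exact lt_of_mul_lt_mul_right h3 (by positivity)
  · have htend : Filter.Tendsto (fun τ : ℝ => σ + τ) (nhds 0) (nhds σ) := by
      have : Continuous fun τ : ℝ => σ + τ := by fun_prop
      simpa using this.tendsto 0
    have h1 := htend.eventually hlocal
    have h2 : ∀ τ : ℝ, z + τ • d = x + (σ + τ) • d := fun τ => by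
      rw [hz, add_smul, add_assoc]
    filter_upwards [h1] with τ hτ
    simpa only [h2, add_zero] using hτ

/-- For a nearly round convex body, radial powers with exponent at most one are convex. -/
theorem convex_radialPow_image [FiniteDimensional ℝ E] {K : Set E} (hK : Convex ℝ K)
    (hcl : IsClosed K) {a : ℝ} (ha : 0 < a) (hin : closedBall 0 a ⊆ K)
    (hout : K ⊆ closedBall 0 (√2 * a)) {s : ℝ} (hs : 0 < s) (hs1 : s ≤ 1) :
    Convex ℝ (radialPow s '' K) := by
  rcases hs1.eq_or_lt with rfl | hs1
  · rwa [radialPow_one_image]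
  have hmem : ∀ x : E, x ∈ radialPow s '' K ↔ radialPow s⁻¹ x ∈ K := by
    intro x
    constructor
    · rintro ⟨y, hy, rfl⟩
      rwa [radialPow_radialPow hs, mul_inv_cancel₀ hs.ne', radialPow_one]
    · intro h
      refine ⟨_, h, ?_⟩
      rw [radialPow_radialPow (inv_pos.2 hs), inv_mul_cancel₀ hs.ne', radialPow_one]
  have hβ : 0 < s⁻¹ - 1 := sub_pos.2 ((one_lt_inv₀ hs).2 hs1)
  have hρ : 0 < √2 * a := by positivity
  intro x hx y hy α γ hα hγ hαγ
  rw [hmem] at hx hy ⊢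
  by_contra hz
  -- The half-space ⟨v, ·⟩ ≤ 1 separating from K pulls back to the region ‖x‖ ^ (s⁻¹ - 1) * ⟨v, x⟩ ≤
  -- 1, convex within the ball of radius (√2 * a) ^ s.
  obtain ⟨f, u, hfK, hfz⟩ := geometric_hahn_banach_closed_point hK hcl hz
  have h0 : (0 : E) ∈ K := hin (mem_closedBall_self ha.le)
  have hu : 0 < u := by simpa using hfK 0 h0
  set v : E := u⁻¹ • (InnerProductSpace.toDual ℝ E).symm f with hv
  have hvf : ∀ w, inner ℝ v w = u⁻¹ * f w := by
    intro w
    rw [hv, inner_smul_left, InnerProductSpace.toDual_symm_apply]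
    simp
  have hvK : ∀ w ∈ K, inner ℝ v w ≤ 1 := by
    intro w hw
    rw [hvf, inv_mul_le_iff₀ hu, mul_one]
    exact (hfK w hw).le
  have hvz : 1 < inner ℝ v (radialPow s⁻¹ (α • x + γ • y)) := by
    rw [hvf, lt_inv_mul_iff₀ hu, mul_one]
    exact hfz
  have hvnorm : ‖v‖ * a ≤ 1 := by
    rcases eq_or_ne v 0 with h | h
    · simp [h]
    have hv0 : 0 < ‖v‖ := norm_pos_iff.2 h
    have := hvK ((a * ‖v‖⁻¹) • v) (hin (by
      rw [mem_closedBall_zero_iff, norm_smul, Real.norm_of_nonneg (by positivity), mul_assoc,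
        inv_mul_cancel₀ hv0.ne', mul_one]))
    rw [inner_smul_right, real_inner_self_eq_norm_sq] at this
    refine le_trans (le_of_eq ?_) this
    field_simp
  -- With ‖v‖ * a ≤ 1 this gives ‖v‖² (√2 a)² ≤ 2, exactly the bound required; this is the source of
  -- √2.
  have hpow : (√2 * a) ^ s * ((√2 * a) ^ s) ^ (s⁻¹ - 1) = √2 * a := by
    rw [← Real.rpow_mul hρ.le, ← Real.rpow_add hρ, mul_sub, mul_inv_cancel₀ hs.ne', mul_one,
      add_sub_cancel, Real.rpow_one]
  have hconv := convex_norm_rpow_mul_inner_le (E := E) (ρ := (√2 * a) ^ s) hβ (v := v) (by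
    rw [hpow, mul_pow, Real.sq_sqrt zero_le_two]
    have : (‖v‖ * a) ^ 2 ≤ 1 := pow_le_one₀ (by positivity) hvnorm
    nlinarith)
  have hin' : ∀ w : E, radialPow s⁻¹ w ∈ K →
      w ∈ {x : E | ‖x‖ ≤ (√2 * a) ^ s ∧ ‖x‖ ^ (s⁻¹ - 1) * inner ℝ v x ≤ 1} := by
    intro w hw
    constructor
    · have h1 := mem_closedBall_zero_iff.1 (hout hw)
      rw [norm_radialPow (inv_pos.2 hs)] at h1
      have h2 := Real.rpow_le_rpow (by positivity) h1 hs.le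
      rwa [Real.rpow_inv_rpow (norm_nonneg w) hs.ne'] at h2
    · have h1 := hvK _ hw
      rwa [radialPow, inner_smul_right] at h1
  have hfinal := (hconv (hin' x hx) (hin' y hy) hα hγ hαγ).2
  rw [radialPow, inner_smul_right] at hvz
  linarith

end

/-! ### Inversion for nearly round bodies -/

section

variable {E : Type*} [NormedAddCommGroup E] [NormedSpace ℝ E] {S : Set ℝ} {A : Set E}

/-- Composite powers are radial powers as long as all intermediate radial powers are convex. -/
theorem powList_eq_radialPow_image (hS : IsExponentRange S) {l : List ℝ} (hl : ∀ s ∈ l, s ∈ S)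
    (h : ∀ s ∈ S, l.prod / s ∈ S → Convex ℝ (radialPow s '' A)) :
    powList l A = radialPow l.prod '' A := by
  induction l generalizing A with
  | nil => rw [List.prod_nil, radialPow_one_image, powList]
  | cons s l ih =>
    rw [List.forall_mem_cons] at hl
    have hs := hS.pos hl.1
    rw [List.prod_cons] at h ⊢
    have hconv := h s hl.1 (by rw [mul_div_cancel_left₀ _ hs.ne']; exact hS.prod_mem hl.2)
    rw [powList, hullPow, hconv.convexHull_eq, ih hl.2, radialPow_image_image hs]
    intro t ht hlt
    rw [radialPow_image_image hs]
    exact h _ (hS.mul_mem hl.1 ht) (by rwa [mul_div_mul_left _ _ hs.ne'])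

/-- Convexity is asked only for exponents between 1 and p. For inversion this matters: K^p has
convex radial powers s only as far as p * s ≤ 1 is known. -/
theorem rangePow_eq_radialPow_image (hS : IsExponentRange S) {p : ℝ} (hp : p ∈ S)
    (hA : IsCompact A) (h : ∀ s ∈ S, p / s ∈ S → Convex ℝ (radialPow s '' A)) :
    rangePow S p A = radialPow p '' A := by
  apply Subset.antisymm
  · refine rangePow_subset (hA.image (continuous_radialPow (hS.pos hp))).isClosed
      fun l hl hlp => ?_
    subst hlp
    exact (powList_eq_radialPow_image hS hl h).le
  · have h1 : ∀ s ∈ [p], s ∈ S := by simpa using hp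
    have h2 := powList_subset_rangePow h1 A
    rw [List.prod_singleton] at h2
    exact (subset_convexHull ℝ _).trans h2

theorem IsOriginBody.powerSet_inv_powerSet {n : ℕ} {K : Set (Euc n)} (hK : IsOriginBody K)
    {a p : ℝ} (ha : 0 < a) (hin : closedBall 0 a ⊆ K) (hout : K ⊆ closedBall 0 (√2 * a))
    (hp : 0 < p) (hp1 : p ≤ 1) : _root_.powerSet p⁻¹ (_root_.powerSet p K) = K := by
  have hconv : ∀ s : ℝ, 0 < s → s ≤ 1 → Convex ℝ (radialPow s '' K) := fun s hs hs1 =>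
    convex_radialPow_image hK.convex hK.isCompact.isClosed ha hin hout hs hs1
  have h1 : _root_.powerSet p K = radialPow p '' K := by
    rw [hK.powerSet_of_le_one hp hp1]
    exact rangePow_eq_radialPow_image isExponentRange_Ioc ⟨hp, hp1⟩ hK.isCompact
      fun s hs _ => hconv s hs.1 hs.2
  have hbody := hK.powerSet hp.le
  have hinv : 1 ≤ p⁻¹ := (one_le_inv₀ hp).2 hp1
  rw [hbody.powerSet_of_one_le hinv, rangePow_eq_radialPow_image isExponentRange_Ici hinv
    hbody.isCompact, h1, radialPow_image_image hp, mul_inv_cancel₀ hp.ne', radialPow_one_image]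
  intro s hs hps
  rw [h1, radialPow_image_image hp]
  have hs0 : 0 < s := one_pos.trans_le hs
  refine hconv _ (mul_pos hp hs0) ?_
  have h2 : s ≤ p⁻¹ := (one_le_div hs0).1 hps
  calc p * s ≤ p * p⁻¹ := by gcongr
    _ = 1 := mul_inv_cancel₀ hp.ne'

end

/-! ### The main theorem -/

/-- Power maps on compact convex bodies with the origin in their interior. -/
theorem mainTheorem3 (n : ℕ) :
    ∃ pow : ℝ≥0 → OriginBody n → OriginBody n,
      -- the construction: closure of the union over all partitions ...
      (∀ (p : ℝ≥0) (K : OriginBody n), (pow p K).toSet = powerSet (p : ℝ) K.toSet) ∧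
      -- ... which is also the limit as the mesh of the partition tends to zero
      (∀ (p : ℝ≥0) (K : OriginBody n), 0 < p → p < 1 → ∀ ε : ℝ, 0 < ε → ε < 1 →
        ∃ δ : ℝ, 0 < δ ∧ ∀ Q : IntervalPartition (p : ℝ) 1, Q.MeshLT δ →
          (1 - ε) • (pow p K).toSet ⊆ lowerPower Q K.toSet ∧
          lowerPower Q K.toSet ⊆ (pow p K).toSet) ∧
      (∀ (p : ℝ≥0) (K : OriginBody n), 1 < p → ∀ ε : ℝ, 0 < ε → ε < 1 →
        ∃ δ : ℝ, 0 < δ ∧ ∀ Q : IntervalPartition 1 (p : ℝ), Q.MeshLT δ →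
          (1 - ε) • (pow p K).toSet ⊆ upperPower Q K.toSet ∧
          upperPower Q K.toSet ⊆ (pow p K).toSet) ∧
      -- (1) normalization
      (∀ K : OriginBody n, pow 1 K = K ∧ (pow 0 K).toSet = closedBall 0 1) ∧
      -- (2) monotonicity
      (∀ (p : ℝ≥0) (K₁ K₂ : OriginBody n), K₁.toSet ⊆ K₂.toSet →
        (pow p K₁).toSet ⊆ (pow p K₂).toSet) ∧
      -- (3) homogeneity
      (∀ (p : ℝ≥0) (K : OriginBody n) (t : ℝ) (ht : 0 < t),
        (pow p (K.dilate t ht)).toSet = (t ^ (p : ℝ)) • (pow p K).toSet) ∧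
      -- (4) joint continuity, for the Hausdorff metric on bodies
      Continuous (fun z : OriginBody n × ℝ≥0 => pow z.2 z.1) ∧
      -- (5) semigroup law on `[0, 1]` and on `[1, ∞)`
      (∀ (p q : ℝ≥0) (K : OriginBody n), (p ≤ 1 ∧ q ≤ 1) ∨ (1 ≤ p ∧ 1 ≤ q) →
        pow q (pow p K) = pow (p * q) K) ∧
      -- (6) inversion for nearly round bodies
      (∀ (K : OriginBody n) (a : ℝ), 0 < a → closedBall 0 a ⊆ K.toSet →
        K.toSet ⊆ closedBall 0 (√2 * a) →
        ∀ p : ℝ≥0, 0 < p → p ≤ 1 → pow p⁻¹ (pow p K) = K) := by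
  refine ⟨OriginBody.pow, fun p K => rfl, ?_, ?_, ?_, ?_, ?_, OriginBody.continuous_pow, ?_, ?_⟩
  · intro p K hp hp1 ε hε hε1
    have hK := K.isOriginBody
    have hp0 : (0 : ℝ) < p := hp
    have hpS : (p : ℝ) ∈ Ioc (0 : ℝ) 1 := ⟨hp0, (show (p : ℝ) < 1 from hp1).le⟩
    have hpow : (K.pow p).toSet = rangePow (Ioc 0 1) (p : ℝ) K.toSet :=
      hK.powerSet_of_le_one hpS.1 hpS.2
    have hε' : 0 < 1 - ε := by linarith
    -- The dilation factor is c = (1 - ε)⁻¹.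
    obtain ⟨δ, hδ, h⟩ := hK.exists_mesh_rangePow_subset isExponentRange_Ioc hpS
      ((one_lt_inv₀ hε').2 (by linarith))
    refine ⟨δ * p, mul_pos hδ hp0, fun Q hQ => ?_⟩
    rw [hpow, Q.lowerPower_eq hp0 hK, smul_set_subset_iff₀ hε'.ne']
    have h2 := powList_subset_rangePow (Q.lowerList_mem hp0) K.toSet
    rw [Q.prod_lowerList hp0] at h2
    exact ⟨h _ (Q.lowerList_mem hp0) (Q.prod_lowerList hp0) (Q.lowerList_step hp0 hδ hQ), h2⟩
  · intro p K hp1 ε hε hε1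
    have hK := K.isOriginBody
    have hpS : (p : ℝ) ∈ Ici (1 : ℝ) := (show (1 : ℝ) < p from hp1).le
    have hpow : (K.pow p).toSet = rangePow (Ici 1) (p : ℝ) K.toSet := hK.powerSet_of_one_le hpS
    have hε' : 0 < 1 - ε := by linarith
    obtain ⟨δ, hδ, h⟩ := hK.exists_mesh_rangePow_subset isExponentRange_Ici hpS
      ((one_lt_inv₀ hε').2 (by linarith))
    refine ⟨δ, hδ, fun Q hQ => ?_⟩
    rw [hpow, Q.upperPower_eq hK, smul_set_subset_iff₀ hε'.ne']
    have h2 := powList_subset_rangePow Q.upperList_mem K.toSet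
    rw [Q.prod_upperList] at h2
    exact ⟨h _ Q.upperList_mem Q.prod_upperList (Q.upperList_step hδ hQ), h2⟩
  · intro K
    refine ⟨OriginBody.ext ?_, powerSet_zero K.toSet⟩
    rw [OriginBody.toSet_pow, NNReal.coe_one, K.isOriginBody.powerSet_of_one_le le_rfl,
      rangePow_one isExponentRange_Ici K.isOriginBody]
  · exact fun p K₁ K₂ h => K₁.isOriginBody.powerSet_mono K₂.isOriginBody p.coe_nonneg h
  · exact fun p K t ht => K.isOriginBody.powerSet_smul p.coe_nonneg ht
  · exact fun p q K h => OriginBody.ext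
      (K.isOriginBody.powerSet_powerSet p.coe_nonneg q.coe_nonneg h)
  · intro K a ha hin hout p hp hp1
    refine OriginBody.ext ?_
    rw [OriginBody.toSet_pow, OriginBody.toSet_pow, NNReal.coe_inv]
    exact K.isOriginBody.powerSet_inv_powerSet ha hin hout hp hp1
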